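/- Let $n\ge 2$ agents, with differentiable local costs $f_1,\dots,f_n:\mathbb R^d\to\mathbb R$, minimize $f=\frac1n\sum_{i=1}^n f_i$. Assume that $\|\nabla f_i(x)-\nabla f_i(y)\|\le \ell\|x-y\|$ for all $x,y$ and $i$, with $\ell>0$, and that $f^*=\inf_x f(x)>-\infty$. The agents communicate over an undirected connected graph with symmetric nonnegative weight matrix $A$ (agents $i\ne j$ are adjacent iff $A_{ij}>0$) and Laplacian $L=\mathrm{diag}(A\mathbf 1)-A$; let $\rho$ be the spectral radius and $\rho_2$ the smallest positive eigenvalue of $L$. Let $\mathcal C:\mathbb R^d\to\mathbb R^d$ be a (possibly randomized) compressor with $$\mathbb E_{\mathcal C}\Big[\Big\|\tfrac{\mathcal C(x)}{r}-x\Big\|^2\Big]\le(1-\delta)\|x\|^2+C\quad\text{for all }x\in\mathbb R^d,$$ where $r>0$, $C>0$, $\delta\in(0,1]$; its internal randomness is drawn afresh, independently of the past, at every iteration. Given $x_{i,0}\in\mathbb R^d$ and $v_{i,0}=\hat x_{i,-1}=y_{i,-1}=0$, the algorithm computes, for $k=0,1,\dots$ and each agent $i$, $$q_{i,k}=\mathcal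 C\big((x_{i,k}-\hat x_{i,k-1})/s_k\big),\quad \hat x_{i,k}=\hat x_{i,k-1}+\omega s_kq_{i,k},\quad y_{i,k}=y_{i,k-1}+\omega s_k\sum_{j=1}^nL_{ij}q_{j,k},$$ $$x_{i,k+1}=x_{i,k}-\alpha\big(\beta y_{i,k}+\gamma v_{i,k}+\nabla f_i(x_{i,k})\big),\quad v_{i,k+1}=v_{i,k}+\alpha\gamma y_{i,k}.$$ Let $\bar x_k=\frac1n\sum_i x_{i,k}$. Suppose that $$\tau_1\ge\kappa_1,\quad \gamma>\kappa_2,\quad \beta=\tau_1\gamma,\quad \omega\in(0,1/r],\quad \alpha\in(0,\hat\kappa_0'),$$ $$s_k=s_0\varepsilon^k,\quad \varepsilon\in(0,1),\quad s_0>0,\quad s_0\ge\max_i\|x_{i,0}\|_p\ \text{ for some } p\in[1,\infty],$$ where $$\kappa_1=\frac4{\rho_2},\qquad \kappa_2=\max\Big\{2+2\ell^2,\ \frac5{\rho_2},\ \sqrt[3]{\frac{16\ell^2(\kappa_1+1)^2}{\rho_2}},\ \frac{2\sqrt2\,\ell}{\rho_2}\Big\},$$ $$\hat\kappa_0'=\min\Big\{\frac{\varphi_1}{\varphi_2'},\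 \frac{\varphi_3}{\varphi_4'},\ \frac{\varphi_5}{\varphi_6},\ \frac{\sqrt{\varphi_7^2+8\varepsilon_{12}\varphi_8'}-\varphi_7}{2\varphi_8'}\Big\},$$ with $\varepsilon_9=\omega r\delta/2$, $\varepsilon_{10}=(1-2\varepsilon_9)(1+\varepsilon_9^{-1})$, $\varepsilon_{12}=(\varepsilon_9+2\varepsilon_9^2)/2$, and $$\varphi_1=\tfrac12\big(\rho_2\beta-(3\gamma+2+2\ell^2)\big),\qquad \varphi_2'=(3+4\varepsilon_{10})\rho^2\beta^2-\rho_2\beta\gamma+(\rho+2)\gamma^2+1+\big(\tfrac52+4\varepsilon_{10}\big)\ell^2,$$ $$\varphi_3=\frac\gamma2-\frac5{2\rho_2},\qquad \varphi_4'=(2+4\varepsilon_{10})\rho\gamma^2+\frac\rho2,\qquad \varphi_5=\frac18-\frac{(\beta+\gamma)^2\ell^2}{\gamma^5\rho_2}-\frac{\ell^2}{2\gamma^2\rho_2^2},$$ $$\varphi_6=\frac{(\beta+\gamma)\ell^2}{2\gamma^3\rho_2}+\frac{\ell^2}{2\gamma^2\rho_2^2}+\frac{\ell^2}{2\rho_2^2}+\frac{\ell^2}2+\frac\ell2,\qquad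 \varphi_7=(\rho+1)\gamma+\frac{\rho\beta}2,$$ $$\varphi_8'=(3+4\varepsilon_{10})\rho^2\beta^2+(\rho-2\rho_2)\beta\gamma+(\rho+2)\gamma^2+1.$$ Then, as $T\to\infty$, with all the expectations below finite, $$\frac1T\sum_{k=0}^{T-1}\mathbb E_{\mathcal C}\Big[\|\nabla f(\bar x_k)\|^2+\frac1n\sum_{i=1}^n\|x_{i,k}-\bar x_k\|^2\Big]=\mathcal O\Big(\frac1T\Big),\qquad \mathbb E_{\mathcal C}\big[f(\bar x_T)-f^*\big]=\mathcal O(1).$$ -/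

import Mathlib

open MeasureTheory ProbabilityTheory Filter Asymptotics
open scoped ENNReal

noncomputable section

namespace CompressedOpt

/-! ### Communication graph -/

/-- The undirected graph underlying a symmetric weighted adjacency matrix: two distinct agents are
joined when the weight between them is positive (a self-loop does not affect the Laplacian). -/
def supportGraph {n : ℕ} (A : Matrix (Fin n) (Fin n) ℝ) : SimpleGraph (Fin n) :=
  SimpleGraph.fromRel (fun i j => 0 < A i j)

/-- `A` is the weighted adjacency matrix of an undirected connected graph. -/
structure IsConnectedWeights {n : ℕ} (A : Matrix (Fin n) (Fin n) ℝ) : Prop where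
  nonneg : ∀ i j, 0 ≤ A i j
  symm : A.IsSymm
  connected : (supportGraph A).Connected

/-- The weighted Laplacian `L = D - A`, with `D` the diagonal matrix of the row sums of `A`. -/
def laplacian {n : ℕ} (A : Matrix (Fin n) (Fin n) ℝ) : Matrix (Fin n) (Fin n) ℝ :=
  Matrix.diagonal (fun i => ∑ j, A i j) - A

/-- The spectral radius `ρ(M)` of a real symmetric matrix, as a real number. -/
def rho {n : ℕ} (M : Matrix (Fin n) (Fin n) ℝ) : ℝ :=
  (spectralRadius ℝ M).toReal

/-- The smallest positive eigenvalue `ρ₂(M)` of a real symmetric matrix. -/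
def rhoTwo {n : ℕ} (M : Matrix (Fin n) (Fin n) ℝ) : ℝ :=
  sInf {μ : ℝ | 0 < μ ∧ μ ∈ spectrum ℝ M}

/-! ### Cost functions -/

/-- The average `n⁻¹ ∑ i, x i` of a family of vectors. -/
def avg {n d : ℕ} (x : Fin n → EuclideanSpace ℝ (Fin d)) : EuclideanSpace ℝ (Fin d) :=
  (n : ℝ)⁻¹ • ∑ i, x i

/-- The global cost `f = n⁻¹ ∑ i, f i`. -/
def globalCost {n d : ℕ} (f : Fin n → EuclideanSpace ℝ (Fin d) → ℝ)
    (x : EuclideanSpace ℝ (Fin d)) : ℝ :=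
  (n : ℝ)⁻¹ * ∑ i, f i x

/-- `g` is differentiable and its gradient is `ℓ`-Lipschitz. -/
def IsSmoothWith {d : ℕ} (ℓ : ℝ) (g : EuclideanSpace ℝ (Fin d) → ℝ) : Prop :=
  Differentiable ℝ g ∧ ∀ x y, ‖gradient g x - gradient g y‖ ≤ ℓ * ‖x - y‖

/-! ### Compressors -/

/-- A randomized compressor is a measurable map `𝒞 : Ξ → ℝᵈ → ℝᵈ`, whose first argument is its
internal randomness, of law `ν`. It is globally bounded with parameters `r`, `δ`, `C` if
`𝔼 ‖𝒞(x)/r - x‖² ≤ (1 - δ)‖x‖² + C` for every `x`. -/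
structure IsGloballyBounded {d : ℕ} {Ξ : Type*} [MeasurableSpace Ξ] (ν : Measure Ξ)
    (𝒞 : Ξ → EuclideanSpace ℝ (Fin d) → EuclideanSpace ℝ (Fin d)) (r δ C : ℝ) : Prop where
  measurable : Measurable (Function.uncurry 𝒞)
  integrable : ∀ x, Integrable (fun ζ => ‖r⁻¹ • 𝒞 ζ x - x‖ ^ 2) ν
  bound : ∀ x, ∫ ζ, ‖r⁻¹ • 𝒞 ζ x - x‖ ^ 2 ∂ν ≤ (1 - δ) * ‖x‖ ^ 2 + C

/-- The internal randomness used along a run of the algorithm: `ξ k i` is the one used by agent `i`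
at iteration `k`. Each has law `ν`, and different iterations are independent. Nothing is required
of the joint law of the agents within one iteration: their randomness may be independent or
shared. -/
structure IsFreshRandomness {n : ℕ} {Ω Ξ : Type*} [MeasurableSpace Ω] [MeasurableSpace Ξ]
    (μ : Measure Ω) (ν : Measure Ξ) (ξ : ℕ → Fin n → Ω → Ξ) : Prop where
  measurable : ∀ k i, Measurable (ξ k i)
  law : ∀ k i, μ.map (ξ k i) = ν
  indep : iIndepFun (fun k w i => ξ k i w) μ

/-! ### The algorithm -/

/-- The variables at the start of iteration `k`: `x = x_k`, `v = v_k`, `xhat = x̂_{k-1}`,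
`y = y_{k-1}`. -/
structure State (n d : ℕ) where
  x : Fin n → EuclideanSpace ℝ (Fin d)
  v : Fin n → EuclideanSpace ℝ (Fin d)
  xhat : Fin n → EuclideanSpace ℝ (Fin d)
  y : Fin n → EuclideanSpace ℝ (Fin d)

/-- The transmitted variables `q_{i,k} = 𝒞((x_{i,k} - x̂_{i,k-1}) / s_k)`, where `ζ i` is the
internal randomness of agent `i` in this iteration. -/
def message {n d : ℕ} {Ξ : Type*}
    (𝒞 : Ξ → EuclideanSpace ℝ (Fin d) → EuclideanSpace ℝ (Fin d))
    (s : ℝ) (ζ : Fin n → Ξ) (S : State n d) (i : Fin n) : EuclideanSpace ℝ (Fin d) :=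
  𝒞 (ζ i) (s⁻¹ • (S.x i - S.xhat i))

/-- The update `x̂_{i,k} = x̂_{i,k-1} + ω s_k q_{i,k}`. -/
def xhatUpdate {n d : ℕ} (ω s : ℝ) (q : Fin n → EuclideanSpace ℝ (Fin d)) (S : State n d)
    (i : Fin n) : EuclideanSpace ℝ (Fin d) :=
  S.xhat i + (ω * s) • q i

/-- The update `y_{i,k} = y_{i,k-1} + ω s_k ∑ j, L i j q_{j,k}`. -/
def yUpdate {n d : ℕ} (L : Matrix (Fin n) (Fin n) ℝ) (ω s : ℝ)
    (q : Fin n → EuclideanSpace ℝ (Fin d)) (S : State n d)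
    (i : Fin n) : EuclideanSpace ℝ (Fin d) :=
  S.y i + (ω * s) • ∑ j, L i j • q j

/-- One iteration, given the transmitted variables `q`. -/
def step {n d : ℕ} (L : Matrix (Fin n) (Fin n) ℝ) (f : Fin n → EuclideanSpace ℝ (Fin d) → ℝ)
    (α β γ ω s : ℝ) (q : Fin n → EuclideanSpace ℝ (Fin d)) (S : State n d) : State n d where
  x i := S.x i - α • (β • yUpdate L ω s q S i + γ • S.v i + gradient (f i) (S.x i))
  v i := S.v i + (α * γ) • yUpdate L ω s q S i
  xhat := xhatUpdate ω s q S
  y := yUpdate L ω s q S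

/-- The run of the algorithm from `x0` (all other variables start at `0`) along the realization
`ζ k i` of the internal randomness; `run … k` is the state at the start of iteration `k`. -/
def run {n d : ℕ} {Ξ : Type*} (L : Matrix (Fin n) (Fin n) ℝ)
    (f : Fin n → EuclideanSpace ℝ (Fin d) → ℝ)
    (𝒞 : Ξ → EuclideanSpace ℝ (Fin d) → EuclideanSpace ℝ (Fin d))
    (α β γ ω : ℝ) (s : ℕ → ℝ) (x0 : Fin n → EuclideanSpace ℝ (Fin d)) (ζ : ℕ → Fin n → Ξ) :
    ℕ → State n d
  | 0 => ⟨x0, 0, 0, 0⟩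
  | k + 1 =>
    let S := run L f 𝒞 α β γ ω s x0 ζ k
    step L f α β γ ω (s k) (message 𝒞 (s k) (ζ k) S) S

/-! ### Parameter thresholds

Below `ρ`, `ρ₂` stand for the spectral radius and the smallest positive eigenvalue of the
Laplacian. -/

def kappaOne (ρ₂ : ℝ) : ℝ := 4 / ρ₂

def kappaTwo (ρ₂ ℓ : ℝ) : ℝ :=
  max (max (2 + 2 * ℓ ^ 2) (5 / ρ₂))
    (max ((16 * ℓ ^ 2 * (kappaOne ρ₂ + 1) ^ 2 / ρ₂) ^ (1 / 3 : ℝ)) (2 * √2 * ℓ / ρ₂))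

def epsNine (ω r δ : ℝ) : ℝ := ω * r * δ / 2

def epsTen (ω r δ : ℝ) : ℝ := (1 - 2 * epsNine ω r δ) * (1 + (epsNine ω r δ)⁻¹)

def epsTwelve (ω r δ : ℝ) : ℝ := (epsNine ω r δ + 2 * epsNine ω r δ ^ 2) / 2

def phiOne (ρ₂ ℓ β γ : ℝ) : ℝ := (ρ₂ * β - (3 * γ + 2 + 2 * ℓ ^ 2)) / 2

def phiTwo' (ρ ρ₂ ℓ β γ ε₁₀ : ℝ) : ℝ :=
  (3 + 4 * ε₁₀) * ρ ^ 2 * β ^ 2 - ρ₂ * β * γ + (ρ + 2) * γ ^ 2 + 1 + (5 / 2 + 4 * ε₁₀) * ℓ ^ 2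

def phiThree (ρ₂ γ : ℝ) : ℝ := γ / 2 - 5 / 2 * ρ₂⁻¹

def phiFour' (ρ γ ε₁₀ : ℝ) : ℝ := (2 + 4 * ε₁₀) * ρ * γ ^ 2 + ρ / 2

def phiFive (ρ₂ ℓ β γ : ℝ) : ℝ :=
  1 / 8 - (β + γ) ^ 2 / γ ^ 5 * ρ₂⁻¹ * ℓ ^ 2 - 1 / (2 * γ ^ 2) * (ρ₂ ^ 2)⁻¹ * ℓ ^ 2

def phiSix (ρ₂ ℓ β γ : ℝ) : ℝ :=
  (β + γ) / (2 * γ ^ 3) * ρ₂⁻¹ * ℓ ^ 2 + 1 / (2 * γ ^ 2) * (ρ₂ ^ 2)⁻¹ * ℓ ^ 2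
    + (ρ₂ ^ 2)⁻¹ / 2 * ℓ ^ 2 + ℓ ^ 2 / 2 + ℓ / 2

def phiSeven (ρ β γ : ℝ) : ℝ := (ρ + 1) * γ + ρ * β / 2

def phiEight' (ρ ρ₂ β γ ε₁₀ : ℝ) : ℝ :=
  (3 + 4 * ε₁₀) * ρ ^ 2 * β ^ 2 + (ρ - 2 * ρ₂) * β * γ + (ρ + 2) * γ ^ 2 + 1

/-- The upper bound on the stepsize `α`. -/
def stepsizeBound (ρ ρ₂ ℓ β γ ω r δ : ℝ) : ℝ :=
  let ε₁₀ := epsTen ω r δ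
  let ε₁₂ := epsTwelve ω r δ
  let φ₇ := phiSeven ρ β γ
  let φ₈ := phiEight' ρ ρ₂ β γ ε₁₀
  min (min (phiOne ρ₂ ℓ β γ / phiTwo' ρ ρ₂ ℓ β γ ε₁₀) (phiThree ρ₂ γ / phiFour' ρ γ ε₁₀))
    (min (phiFive ρ₂ ℓ β γ / phiSix ρ₂ ℓ β γ) ((√(φ₇ ^ 2 + 8 * ε₁₂ * φ₈) - φ₇) / (2 * φ₈)))

end CompressedOpt

end

/-!
Diagonalise the Laplacian. On each nonzero eigenmode a quadratic form in the coefficients of the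
positions `x` and of the shifted dual variable `v + γ⁻¹ ∇f(x̄)` is coercive, and for small `α` it
decreases up to the gradient mismatch, the drift of `∇f(x̄)` and the estimation error `x - x̂`.
Summing over the modes and adding `n (f(x̄) - f*)`, whose decrease under one step absorbs the
drift, gives a Lyapunov function in which only the error `‖x - x̂‖²` remains as a perturbation.
Because the randomness of an iteration is independent of the current state, the compressor
contracts that error in expectation by the factor `1 - ω r δ`, up to a noise of order `s_k²`.
The error, added with weight one, therefore pays for its own contribution; the noise is summable,
and telescoping bounds both the cost and the accumulated stationarity gaps.
-/

noncomputable section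

namespace CompressedOpt

open scoped RealInnerProductSpace

section Young

variable {E : Type*} [NormedAddCommGroup E] [InnerProductSpace ℝ E]

theorem mul_inner_le_of_sq_le {k p q : ℝ} (hp : 0 ≤ p) (hq : 0 ≤ q) (h : k ^ 2 ≤ 4 * p * q)
    (x y : E) : k * ⟪x, y⟫ ≤ p * ‖x‖ ^ 2 + q * ‖y‖ ^ 2 := by
  have cauchy_schwarz : ⟪x, y⟫ ^ 2 ≤ (‖x‖ * ‖y‖) ^ 2 :=
    sq_le_sq' (neg_le_of_abs_le (abs_real_inner_le_norm x y)) (real_inner_le_norm x y)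
  have hsq : (k * ⟪x, y⟫) ^ 2 ≤ (p * ‖x‖ ^ 2 + q * ‖y‖ ^ 2) ^ 2 :=
    calc (k * ⟪x, y⟫) ^ 2 ≤ 4 * p * q * (‖x‖ * ‖y‖) ^ 2 := by
          rw [mul_pow]; gcongr
      _ ≤ (p * ‖x‖ ^ 2 + q * ‖y‖ ^ 2) ^ 2 := by
          linarith [sq_nonneg (p * ‖x‖ ^ 2 - q * ‖y‖ ^ 2)]
  exact (abs_le.1 (abs_le_of_sq_le_sq hsq (by positivity))).2

theorem norm_add_sq_le_weighted {c : ℝ} (hc : 0 < c) (x y : E) :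
    ‖x + y‖ ^ 2 ≤ (1 + c) * ‖x‖ ^ 2 + (1 + c⁻¹) * ‖y‖ ^ 2 := by
  have cross := mul_inner_le_of_sq_le (k := 2) hc.le (inv_nonneg.2 hc.le)
    (by field_simp; norm_num) x y
  linarith [norm_add_sq_real x y]

theorem norm_add_sq_le_two_mul (x y : E) : ‖x + y‖ ^ 2 ≤ 2 * ‖x‖ ^ 2 + 2 * ‖y‖ ^ 2 := by
  linarith [norm_add_sq_le_weighted one_pos x y]

theorem norm_sub_sq_le_two_mul (x y : E) : ‖x - y‖ ^ 2 ≤ 2 * ‖x‖ ^ 2 + 2 * ‖y‖ ^ 2 := by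
  simpa only [sub_eq_add_neg, norm_neg] using norm_add_sq_le_two_mul x (-y)

theorem norm_smul_sq (c : ℝ) (x : E) : ‖c • x‖ ^ 2 = c ^ 2 * ‖x‖ ^ 2 := by
  rw [norm_smul, mul_pow, Real.norm_eq_abs, sq_abs]

end Young

section ModeEnergy

variable {E : Type*} [NormedAddCommGroup E] [InnerProductSpace ℝ E]

/-- The energy carried by an eigenspace of the Laplacian of eigenvalue `l`, where `u` is the
component of the positions and `w` that of `v` plus `γ⁻¹` times the gradients. The coupling `l⁻¹`
and the weight of `‖w‖²` make the cross terms in `⟪u, w⟫` cancel to first order in the stepsize. -/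
def modeEnergy (β γ l : ℝ) (u w : E) : ℝ :=
  1 / 2 * ‖u‖ ^ 2 + l⁻¹ * ⟪u, w⟫ + (β + γ) / (2 * γ * l) * ‖w‖ ^ 2

/-- The weight of the squared change of the gradients in the one-step estimate of `modeEnergy`, for
eigenvalues at least `l`. -/
def gradDriftCoeff (α β γ l : ℝ) : ℝ :=
  1 / α * (1 / (2 * γ ^ 2) * (l ^ 2)⁻¹ + (β + γ) ^ 2 / γ ^ 5 * l⁻¹)
    + (1 / 2 + (l ^ 2)⁻¹ / 2 + 1 / (2 * γ ^ 2) * (l ^ 2)⁻¹ + (β + γ) / (2 * γ ^ 3) * l⁻¹)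

variable {α β γ l ρ₂ ρ c : ℝ}

theorem gradDriftCoeff_anti (hα : 0 < α) (hβ : 0 < β) (hγ : 0 < γ) (hρ₂ : 0 < ρ₂) (hl : ρ₂ ≤ l) :
    gradDriftCoeff α β γ l ≤ gradDriftCoeff α β γ ρ₂ := by
  unfold gradDriftCoeff
  gcongr

theorem gradDriftCoeff_nonneg (hα : 0 < α) (hβ : 0 < β) (hγ : 0 < γ) (hl : 0 < l) :
    0 ≤ gradDriftCoeff α β γ l := by
  unfold gradDriftCoeff
  positivity

theorem modeEnergy_nonneg (hγ : 0 < γ) (hl : 0 < l) (h : γ ≤ l * β) (u w : E) :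
    0 ≤ modeEnergy β γ l u w := by
  have hβ : 0 < β := pos_of_mul_pos_right (hγ.trans_le h) hl.le
  have cross := mul_inner_le_of_sq_le (k := -l⁻¹) (p := 1 / 2) (q := (β + γ) / (2 * γ * l))
    (by norm_num) (by positivity) (by
      rw [neg_sq, inv_pow, inv_eq_one_div,
        show 4 * (1 / 2) * ((β + γ) / (2 * γ * l)) = (β + γ) / (γ * l) by field_simp; ring,
        div_le_div_iff₀ (by positivity) (by positivity)]
      nlinarith [mul_le_mul_of_nonneg_right h hl.le, mul_pos hγ (pow_pos hl 2)]) u w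
  unfold modeEnergy
  linarith

/-- The direction in which the position component of a mode is moved, when `e` is the component of
the compression error and `a` that of the gradients at the average. -/
def modeDirection (β γ l : ℝ) (u w e a : E) : E := (β * l) • (u - e) + (γ • w + a)

theorem norm_modeDirection_sq_le (β γ l : ℝ) (u w e a : E) :
    ‖modeDirection β γ l u w e a‖ ^ 2 ≤ 4 * (β * l) ^ 2 * (‖u‖ ^ 2 + ‖e‖ ^ 2)
      + 4 * γ ^ 2 * ‖w‖ ^ 2 + 4 * ‖a‖ ^ 2 := by
  have h₁ := norm_add_sq_le_two_mul ((β * l) • (u - e)) (γ • w + a)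
  have h₂ := norm_add_sq_le_two_mul (γ • w) a
  have h₃ := mul_le_mul_of_nonneg_left (norm_sub_sq_le_two_mul u e) (sq_nonneg (β * l))
  rw [norm_smul_sq] at h₁ h₂
  unfold modeDirection
  linarith

theorem modeEnergy_step_eq (hγ : γ ≠ 0) (hl : l ≠ 0) (u w e a Δ : E) :
    modeEnergy β γ l (u - α • modeDirection β γ l u w e a)
        (w + (α * γ * l) • (u - e) + γ⁻¹ • Δ)
      = modeEnergy β γ l u w
        + α * (-(β * l - γ) * ‖u‖ ^ 2 - γ / l * ‖w‖ ^ 2 + (β * l - γ) * ⟪u, e⟫ - γ * ⟪e, w⟫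
          - ⟪u, a⟫ - 1 / l * ⟪a, w⟫)
        + α ^ 2 * (1 / 2 * ‖(β * l - γ) • (u - e) + (γ • w + a)‖ ^ 2
          + γ / 2 * ((β + γ) * l - γ) * ‖u - e‖ ^ 2)
        + (1 / (γ * l) * ⟪u, Δ⟫ + (β + γ) / (γ ^ 2 * l) * ⟪w, Δ⟫ + α * ⟪u - e, Δ⟫
          - α / l * ⟪w, Δ⟫ - α / (γ * l) * ⟪a, Δ⟫ + (β + γ) / (2 * γ ^ 3 * l) * ‖Δ‖ ^ 2) := by
  simp only [modeEnergy, modeDirection, ← real_inner_self_eq_norm_sq, inner_add_left,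
    inner_add_right, inner_sub_left, inner_sub_right, inner_smul_left, inner_smul_right,
    RCLike.conj_to_real]
  rw [real_inner_comm u e, real_inner_comm u w, real_inner_comm u a, real_inner_comm u Δ,
    real_inner_comm w e, real_inner_comm w a, real_inner_comm w Δ, real_inner_comm e a,
    real_inner_comm e Δ]
  field_simp
  ring

theorem modeEnergy_firstOrder_le (hγ : 0 < γ) (hρ₂ : 0 < ρ₂) (hl : ρ₂ ≤ l) (hlρ : l ≤ ρ)
    (hβ : 0 < β) (hγβ : γ ≤ ρ₂ * β) (u w e a : E) :
    -(β * l - γ) * ‖u‖ ^ 2 - γ / l * ‖w‖ ^ 2 + (β * l - γ) * ⟪u, e⟫ - γ * ⟪e, w⟫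
        - ⟪u, a⟫ - 1 / l * ⟪a, w⟫
      ≤ -((ρ₂ * β - 3 * γ - 1) / 2) * ‖u‖ ^ 2 - (3 * γ / 4 - 1 / 2 * ρ₂⁻¹) / l * ‖w‖ ^ 2
        + phiSeven ρ β γ * ‖e‖ ^ 2 + ‖a‖ ^ 2 := by
  have hl0 : 0 < l := hρ₂.trans_le hl
  have hβl : ρ₂ * β ≤ β * l := by rw [mul_comm]; gcongr
  have ue := mul_inner_le_of_sq_le (k := β * l - γ) (p := (β * l - γ) / 2)
    (q := (β * l - γ) / 2) (by linarith) (by linarith) (by linarith) u e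
  have ew := mul_inner_le_of_sq_le (k := -γ) (p := γ * l) (q := γ / (4 * l))
    (by positivity) (by positivity) (by field_simp; rfl) e w
  have ua := mul_inner_le_of_sq_le (k := -1) (p := 1 / 2) (q := 1 / 2)
    (by norm_num) (by norm_num) (by norm_num) u a
  have aw := mul_inner_le_of_sq_le (k := -(1 / l)) (p := 1 / 2) (q := 1 / 2 * ρ₂⁻¹ / l)
    (by norm_num) (by positivity) (by field_simp; linarith) a w
  have hu : -((β * l - γ - 1) / 2) * ‖u‖ ^ 2 ≤ -((ρ₂ * β - 3 * γ - 1) / 2) * ‖u‖ ^ 2 := by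
    gcongr; linarith
  have he : ((β * l - γ) / 2 + γ * l) * ‖e‖ ^ 2 ≤ phiSeven ρ β γ * ‖e‖ ^ 2 := by
    have : β * l ≤ β * ρ := by gcongr
    have : γ * l ≤ γ * ρ := by gcongr
    refine mul_le_mul_of_nonneg_right ?_ (sq_nonneg _)
    unfold phiSeven
    linarith
  have hw : (3 * γ / 4 - 1 / 2 * ρ₂⁻¹) / l = γ / l - γ / (4 * l) - 1 / 2 * ρ₂⁻¹ / l := by
    field_simp; ring
  rw [hw]
  linarith

theorem modeEnergy_secondOrder_le (hγ : 0 < γ) (hρ₂ : 0 < ρ₂) (hl : ρ₂ ≤ l) (hlρ : l ≤ ρ)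
    (hβ : 0 < β) (hγβ : 3 * γ ≤ ρ₂ * β) (hc : 0 ≤ c) (u w e a : E) :
    1 / 2 * ‖(β * l - γ) • (u - e) + (γ • w + a)‖ ^ 2
        + γ / 2 * ((β + γ) * l - γ) * ‖u - e‖ ^ 2 + c * ‖modeDirection β γ l u w e a‖ ^ 2
      ≤ ((2 + 4 * c) * ρ ^ 2 * β ^ 2 - 3 * ρ₂ * β * γ + (ρ + 1) * γ ^ 2) * (‖u‖ ^ 2 + ‖e‖ ^ 2)
        + (2 + 4 * c) * γ ^ 2 * ‖w‖ ^ 2 + (2 + 4 * c) * ‖a‖ ^ 2 := by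
  have hl0 : 0 < l := hρ₂.trans_le hl
  have hβl : ρ₂ * β ≤ β * l := by rw [mul_comm]; gcongr
  have split := norm_add_sq_le_two_mul ((β * l - γ) • (u - e)) (γ • w + a)
  have wa := norm_add_sq_le_two_mul (γ • w) a
  rw [norm_smul_sq] at split wa
  have ue : ((β * l - γ) ^ 2 + γ / 2 * ((β + γ) * l - γ)) * ‖u - e‖ ^ 2
      ≤ ((β * l - γ) ^ 2 + γ / 2 * ((β + γ) * l - γ)) * (2 * ‖u‖ ^ 2 + 2 * ‖e‖ ^ 2) := by
    have : 0 ≤ (β * l - γ) ^ 2 + γ / 2 * ((β + γ) * l - γ) := by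
      nlinarith [mul_pos hγ hl0]
    gcongr
    exact norm_sub_sq_le_two_mul u e
  have coeff_le : 2 * ((β * l - γ) ^ 2 + γ / 2 * ((β + γ) * l - γ)) + 4 * c * (β * l) ^ 2
      ≤ (2 + 4 * c) * ρ ^ 2 * β ^ 2 - 3 * ρ₂ * β * γ + (ρ + 1) * γ ^ 2 := by
    have h₁ : (2 + 4 * c) * (β * l) ^ 2 ≤ (2 + 4 * c) * (β * ρ) ^ 2 := by gcongr
    have h₂ : ρ₂ * β * γ ≤ β * l * γ := by gcongr
    have h₃ : l * γ ^ 2 ≤ ρ * γ ^ 2 := by gcongr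
    linarith
  have dir := mul_le_mul_of_nonneg_left (norm_modeDirection_sq_le β γ l u w e a) hc
  linarith [mul_le_mul_of_nonneg_right coeff_le (by positivity : 0 ≤ ‖u‖ ^ 2 + ‖e‖ ^ 2)]

theorem modeEnergy_drift_le (hα : 0 < α) (hβ : 0 < β) (hγ : 0 < γ) (hl : 0 < l) (u w e a Δ : E) :
    1 / (γ * l) * ⟪u, Δ⟫ + (β + γ) / (γ ^ 2 * l) * ⟪w, Δ⟫ + α * ⟪u - e, Δ⟫
        - α / l * ⟪w, Δ⟫ - α / (γ * l) * ⟪a, Δ⟫ + (β + γ) / (2 * γ ^ 3 * l) * ‖Δ‖ ^ 2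
      ≤ α / 2 * ‖u‖ ^ 2 + α * γ / (4 * l) * ‖w‖ ^ 2 + α ^ 2 * (‖u‖ ^ 2 + ‖e‖ ^ 2)
        + α ^ 2 / 2 * ‖w‖ ^ 2 + α ^ 2 / 2 * ‖a‖ ^ 2 + gradDriftCoeff α β γ l * ‖Δ‖ ^ 2 := by
  have uΔ := mul_inner_le_of_sq_le (k := 1 / (γ * l)) (p := α / 2)
    (q := 1 / α * (1 / (2 * γ ^ 2) * (l ^ 2)⁻¹)) (by positivity) (by positivity)
    (by field_simp; norm_num) u Δ
  have wΔ := mul_inner_le_of_sq_le (k := (β + γ) / (γ ^ 2 * l)) (p := α * γ / (4 * l))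
    (q := 1 / α * ((β + γ) ^ 2 / γ ^ 5 * l⁻¹)) (by positivity) (by positivity)
    (by field_simp; rfl) w Δ
  have ueΔ := mul_inner_le_of_sq_le (k := α) (p := α ^ 2 / 2) (q := 1 / 2)
    (by positivity) (by norm_num) (by linarith) (u - e) Δ
  have wΔ' := mul_inner_le_of_sq_le (k := -(α / l)) (p := α ^ 2 / 2) (q := (l ^ 2)⁻¹ / 2)
    (by positivity) (by positivity) (by field_simp; norm_num) w Δ
  have aΔ := mul_inner_le_of_sq_le (k := -(α / (γ * l))) (p := α ^ 2 / 2)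
    (q := 1 / (2 * γ ^ 2) * (l ^ 2)⁻¹) (by positivity) (by positivity)
    (by field_simp; norm_num) a Δ
  have ue := mul_le_mul_of_nonneg_left (norm_sub_sq_le_two_mul u e) (sq_nonneg α)
  have ΔΔ : (β + γ) / (2 * γ ^ 3 * l) = (β + γ) / (2 * γ ^ 3) * l⁻¹ := by field_simp
  rw [ΔΔ]
  unfold gradDriftCoeff
  linarith

theorem dualCoeff_div_le (hα : 0 < α) (hρ₂ : 0 < ρ₂) (hl : ρ₂ ≤ l) (hlρ : l ≤ ρ) (hc : 0 ≤ c) :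
    (α * phiThree ρ₂ γ - α ^ 2 * phiFour' ρ γ c) / l
      ≤ α * ((3 * γ / 4 - 1 / 2 * ρ₂⁻¹) / l) - α * γ / (4 * l)
        - α ^ 2 * ((2 + 4 * c) * γ ^ 2 + 1 / 2) := by
  have hl0 : 0 < l := hρ₂.trans_le hl
  have numerator_le : α * phiThree ρ₂ γ - α ^ 2 * phiFour' ρ γ c
      ≤ α * (γ / 2 - 1 / 2 * ρ₂⁻¹) - α ^ 2 * (((2 + 4 * c) * γ ^ 2 + 1 / 2) * l) := by
    have second : α ^ 2 * (((2 + 4 * c) * γ ^ 2 + 1 / 2) * l)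
        ≤ α ^ 2 * (((2 + 4 * c) * γ ^ 2 + 1 / 2) * ρ) := by gcongr
    have first := mul_pos hα (inv_pos.2 hρ₂)
    unfold phiThree phiFour'
    linarith
  refine (div_le_div_of_nonneg_right numerator_le hl0.le).trans_eq ?_
  field_simp
  ring

theorem modeEnergy_step_le (hα : 0 < α) (hγ : 0 < γ) (hρ₂ : 0 < ρ₂) (hl : ρ₂ ≤ l) (hlρ : l ≤ ρ)
    (hγβ : 3 * γ ≤ ρ₂ * β) (hc : 0 ≤ c) (u w e a Δ : E) :
    modeEnergy β γ l (u - α • modeDirection β γ l u w e a)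
        (w + (α * γ * l) • (u - e) + γ⁻¹ • Δ)
        + c * ‖α • modeDirection β γ l u w e a‖ ^ 2
      ≤ modeEnergy β γ l u w
        - (α * phiOne ρ₂ 0 β γ - α ^ 2 * phiTwo' ρ ρ₂ 0 β γ c) * ‖u‖ ^ 2
        - (α * phiThree ρ₂ γ - α ^ 2 * phiFour' ρ γ c) / l * ‖w‖ ^ 2
        + (α * phiSeven ρ β γ + α ^ 2 * phiEight' ρ ρ₂ β γ c) * ‖e‖ ^ 2
        + (α + α ^ 2 * (5 / 2 + 4 * c)) * ‖a‖ ^ 2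
        + gradDriftCoeff α β γ ρ₂ * ‖Δ‖ ^ 2 := by
  have hl0 : 0 < l := hρ₂.trans_le hl
  have hρ : 0 < ρ := hl0.trans_le hlρ
  have hβ : 0 < β := pos_of_mul_pos_right ((by positivity : 0 < 3 * γ).trans_le hγβ) hρ₂.le
  have first := mul_le_mul_of_nonneg_left
    (modeEnergy_firstOrder_le hγ hρ₂ hl hlρ hβ (by linarith) u w e a) hα.le
  have second := mul_le_mul_of_nonneg_left
    (modeEnergy_secondOrder_le hγ hρ₂ hl hlρ hβ hγβ hc u w e a) (sq_nonneg α)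
  have drift := modeEnergy_drift_le hα hβ hγ hl0 u w e a Δ
  have driftΔ := mul_le_mul_of_nonneg_right (gradDriftCoeff_anti hα hβ hγ hρ₂ hl) (sq_nonneg ‖Δ‖)
  have hu : 0 ≤ (α ^ 2 * (ρ ^ 2 * β ^ 2 + γ ^ 2) + 2 * (α ^ 2 * (ρ₂ * β * γ))) * ‖u‖ ^ 2 := by
    positivity
  have he : 0 ≤ (α ^ 2 * (ρ ^ 2 * β ^ 2 + γ ^ 2) + α ^ 2 * (ρ * β * γ)
      + α ^ 2 * (ρ₂ * β * γ)) * ‖e‖ ^ 2 := by positivity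
  have hw := mul_le_mul_of_nonneg_right (dualCoeff_div_le (γ := γ) hα hρ₂ hl hlρ hc)
    (sq_nonneg ‖w‖)
  rw [modeEnergy_step_eq hγ.ne' hl0.ne', norm_smul_sq]
  unfold phiOne phiTwo' phiEight'
  linarith

end ModeEnergy

section Average

variable {n d : ℕ}

theorem nsmul_avg (x : Fin n → EuclideanSpace ℝ (Fin d)) : (n : ℝ) • avg x = ∑ i, x i := by
  rcases eq_or_ne n 0 with rfl | hn
  · simp
  · rw [avg, smul_inv_smul₀ (Nat.cast_ne_zero.2 hn)]

theorem avg_sub (x y : Fin n → EuclideanSpace ℝ (Fin d)) : avg (x - y) = avg x - avg y := by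
  simp only [avg, Pi.sub_apply, Finset.sum_sub_distrib, smul_sub]

theorem avg_smul (c : ℝ) (x : Fin n → EuclideanSpace ℝ (Fin d)) : avg (c • x) = c • avg x := by
  simp only [avg, Pi.smul_apply, ← Finset.smul_sum, smul_comm c]

/-- The squared deviation of a family of vectors from its average. -/
def disagreement (x : Fin n → EuclideanSpace ℝ (Fin d)) : ℝ := ∑ i, ‖x i - avg x‖ ^ 2

theorem disagreement_nonneg (x : Fin n → EuclideanSpace ℝ (Fin d)) : 0 ≤ disagreement x := by
  unfold disagreement
  positivity

theorem sum_sub_avg (x : Fin n → EuclideanSpace ℝ (Fin d)) : ∑ i, (x i - avg x) = 0 := by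
  rw [Finset.sum_sub_distrib, Finset.sum_const, Finset.card_univ, Fintype.card_fin,
    ← Nat.cast_smul_eq_nsmul ℝ, nsmul_avg, sub_self]

theorem sum_norm_sq_eq_disagreement_add (x : Fin n → EuclideanSpace ℝ (Fin d)) :
    ∑ i, ‖x i‖ ^ 2 = disagreement x + n * ‖avg x‖ ^ 2 := by
  have expand : ∀ i, ‖x i‖ ^ 2 = ‖x i - avg x‖ ^ 2 + 2 * ⟪x i - avg x, avg x⟫ + ‖avg x‖ ^ 2 :=
    fun i => by rw [← norm_add_sq_real, sub_add_cancel]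
  simp only [expand, Finset.sum_add_distrib, ← Finset.mul_sum, ← sum_inner, sum_sub_avg,
    inner_zero_left, Finset.sum_const, Finset.card_univ, Fintype.card_fin, nsmul_eq_mul,
    disagreement]
  ring

theorem disagreement_le_sum_norm_sq (x : Fin n → EuclideanSpace ℝ (Fin d)) :
    disagreement x ≤ ∑ i, ‖x i‖ ^ 2 := by
  rw [sum_norm_sq_eq_disagreement_add]
  exact le_add_of_nonneg_right (by positivity)

end Average

section WeightedSum

variable {ι E : Type*} [Fintype ι]

/-- The combination `∑ i, b i • x i` of a family of vectors, as a linear map of the family. -/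
def weightedSum [AddCommGroup E] [Module ℝ E] (b : ι → ℝ) : (ι → E) →ₗ[ℝ] E :=
  ∑ i, b i • LinearMap.proj i

theorem weightedSum_apply [AddCommGroup E] [Module ℝ E] (b : ι → ℝ) (x : ι → E) :
    weightedSum b x = ∑ i, b i • x i := by
  simp [weightedSum]

/-- The action of a matrix of real numbers on a family of vectors. -/
def matrixAct [AddCommGroup E] [Module ℝ E] (M : Matrix ι ι ℝ) (x : ι → E) : ι → E :=
  fun i => ∑ k, M i k • x k

theorem matrixAct_add [AddCommGroup E] [Module ℝ E] (M : Matrix ι ι ℝ) (x y : ι → E) :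
    matrixAct M (x + y) = matrixAct M x + matrixAct M y := by
  ext i
  simp only [matrixAct, Pi.add_apply, smul_add, Finset.sum_add_distrib]

theorem matrixAct_smul [AddCommGroup E] [Module ℝ E] (M : Matrix ι ι ℝ) (c : ℝ) (x : ι → E) :
    matrixAct M (c • x) = c • matrixAct M x := by
  ext i
  simp only [matrixAct, Pi.smul_apply, Finset.smul_sum, smul_comm c]

theorem weightedSum_matrixAct [AddCommGroup E] [Module ℝ E] {M : Matrix ι ι ℝ}
    (hM : M.IsSymm) {b : ι → ℝ} {l : ℝ} (hb : M.mulVec b = l • b) (x : ι → E) :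
    weightedSum b (matrixAct M x) = l • weightedSum b x := by
  have hb' : ∀ k, ∑ i, b i * M i k = l * b k := fun k => by
    rw [← smul_eq_mul l, ← Pi.smul_apply, ← hb]
    exact Finset.sum_congr rfl fun i _ => by rw [mul_comm, hM.apply]
  simp only [weightedSum_apply, matrixAct, Finset.smul_sum, smul_smul]
  rw [Finset.sum_comm]
  simp only [← Finset.sum_smul, hb']

theorem sum_norm_sq_weightedSum [NormedAddCommGroup E] [InnerProductSpace ℝ E]
    (b : OrthonormalBasis ι ℝ (EuclideanSpace ℝ ι)) (x : ι → E) :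
    ∑ j, ‖weightedSum (b j) x‖ ^ 2 = ∑ i, ‖x i‖ ^ 2 := by
  classical
  have completeness : ∀ i k, ∑ j, b j i * b j k = if i = k then 1 else 0 := fun i k => by
    have h := b.sum_inner_mul_inner (EuclideanSpace.single i (1 : ℝ)) (EuclideanSpace.single k 1)
    simpa [EuclideanSpace.inner_single_left, EuclideanSpace.inner_single_right,
      Pi.single_apply, eq_comm] using h
  calc ∑ j, ‖weightedSum (b j) x‖ ^ 2
      = ∑ j, ∑ i, ∑ k, b j i * b j k * ⟪x i, x k⟫ := by
        simp only [← real_inner_self_eq_norm_sq, weightedSum_apply, sum_inner, inner_sum,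
          real_inner_smul_right, mul_assoc, real_inner_comm,
          mul_left_comm]
    _ = ∑ i, ∑ k, (∑ j, b j i * b j k) * ⟪x i, x k⟫ := by
        simp only [Finset.sum_mul]
        rw [Finset.sum_comm]
        exact Finset.sum_congr rfl fun i _ => Finset.sum_comm
    _ = ∑ i, ‖x i‖ ^ 2 := by
        simp only [completeness, ite_mul, one_mul, zero_mul, Finset.sum_ite_eq, Finset.mem_univ,
          if_true, real_inner_self_eq_norm_sq]

end WeightedSum

section Spectrum

variable {n : ℕ} {M : Matrix (Fin n) (Fin n) ℝ} {l : ℝ}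

theorem le_rho_of_mem_spectrum (hl : l ∈ spectrum ℝ M) : l ≤ rho M := by
  obtain ⟨B, hB⟩ := ((Matrix.finite_real_spectrum (A := M)).image fun k => ‖k‖₊).bddAbove
  have radius_lt_top : spectralRadius ℝ M < ⊤ :=
    (iSup₂_le fun k hk => by exact_mod_cast hB ⟨k, hk, rfl⟩).trans_lt (ENNReal.coe_lt_top (r := B))
  have norm_le : (‖l‖₊ : ℝ≥0∞) ≤ spectralRadius ℝ M :=
    le_iSup₂ (f := fun k (_ : k ∈ spectrum ℝ M) => (‖k‖₊ : ℝ≥0∞)) l hl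
  calc l ≤ ‖l‖ := le_abs_self l
    _ ≤ rho M := ENNReal.toReal_mono radius_lt_top.ne norm_le

theorem rhoTwo_le_of_mem_spectrum (hl₀ : 0 < l) (hl : l ∈ spectrum ℝ M) : rhoTwo M ≤ l :=
  csInf_le ⟨0, fun _ h => h.1.le⟩ ⟨hl₀, hl⟩

theorem rhoTwo_pos_of_mem_spectrum (hl₀ : 0 < l) (hl : l ∈ spectrum ℝ M) : 0 < rhoTwo M :=
  (Set.Nonempty.csInf_mem (s := {μ | 0 < μ ∧ μ ∈ spectrum ℝ M}) ⟨l, hl₀, hl⟩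
    (Matrix.finite_real_spectrum.subset fun _ h => h.2)).1

end Spectrum

section Laplacian

open scoped Matrix

variable {n : ℕ} {A : Matrix (Fin n) (Fin n) ℝ}

theorem isSymm_laplacian (hA : A.IsSymm) : (laplacian A).IsSymm := by
  rw [Matrix.IsSymm, laplacian, Matrix.transpose_sub, Matrix.diagonal_transpose, hA.eq]

theorem isHermitian_laplacian (hA : A.IsSymm) : (laplacian A).IsHermitian := by
  rw [Matrix.IsHermitian, Matrix.conjTranspose_eq_transpose_of_trivial, isSymm_laplacian hA]

theorem laplacian_mulVec_apply (v : Fin n → ℝ) (i : Fin n) :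
    (laplacian A *ᵥ v) i = ∑ j, A i j * (v i - v j) := by
  rw [laplacian, Matrix.sub_mulVec, Pi.sub_apply, Matrix.mulVec_diagonal, Finset.sum_mul]
  simp only [Matrix.mulVec, dotProduct, mul_sub, Finset.sum_sub_distrib]

theorem laplacian_mulVec_one : laplacian A *ᵥ 1 = 0 := by
  ext i
  simp [laplacian_mulVec_apply]

theorem sum_laplacian_col (hA : A.IsSymm) (k : Fin n) : ∑ i, laplacian A i k = 0 := by
  have row := congrFun (laplacian_mulVec_one (A := A)) k
  simp only [Matrix.mulVec, dotProduct, Pi.one_apply, mul_one, Pi.zero_apply] at row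
  simpa only [(isSymm_laplacian hA).apply] using row

theorem sum_matrixAct_laplacian {E : Type*} [AddCommGroup E] [Module ℝ E] (hA : A.IsSymm)
    (z : Fin n → E) : ∑ i, matrixAct (laplacian A) z i = 0 := by
  simp only [matrixAct]
  rw [Finset.sum_comm]
  simp only [← Finset.sum_smul, sum_laplacian_col hA, zero_smul, Finset.sum_const_zero]

theorem two_mul_dotProduct_laplacian_mulVec (hA : A.IsSymm) (v : Fin n → ℝ) :
    2 * (v ⬝ᵥ laplacian A *ᵥ v) = ∑ i, ∑ j, A i j * (v i - v j) ^ 2 := by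
  have form : v ⬝ᵥ laplacian A *ᵥ v = ∑ i, ∑ j, A i j * (v i * (v i - v j)) := by
    simp only [dotProduct, laplacian_mulVec_apply, Finset.mul_sum]
    exact Finset.sum_congr rfl fun i _ => Finset.sum_congr rfl fun j _ => by ring
  have form_swap : v ⬝ᵥ laplacian A *ᵥ v = ∑ i, ∑ j, A i j * (v j * (v j - v i)) := by
    rw [form, Finset.sum_comm]
    simp only [hA.apply]
  calc 2 * (v ⬝ᵥ laplacian A *ᵥ v)
      = ∑ i, ∑ j, A i j * (v i * (v i - v j)) + ∑ i, ∑ j, A i j * (v j * (v j - v i)) := by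
        rw [two_mul, ← form, ← form_swap]
    _ = ∑ i, ∑ j, A i j * (v i - v j) ^ 2 := by
        simp only [← Finset.sum_add_distrib]
        exact Finset.sum_congr rfl fun i _ => Finset.sum_congr rfl fun j _ => by ring

namespace IsConnectedWeights

theorem posSemidef_laplacian (hA : IsConnectedWeights A) : (laplacian A).PosSemidef := by
  refine .of_dotProduct_mulVec_nonneg (isHermitian_laplacian hA.symm) fun v => ?_
  have : 0 ≤ ∑ i, ∑ j, A i j * (v i - v j) ^ 2 :=
    Finset.sum_nonneg fun i _ => Finset.sum_nonneg fun j _ =>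
      mul_nonneg (hA.nonneg i j) (sq_nonneg _)
  rw [star_trivial]
  linarith [two_mul_dotProduct_laplacian_mulVec hA.symm v]

theorem eq_of_laplacian_mulVec_eq_zero (hA : IsConnectedWeights A) {v : Fin n → ℝ}
    (hv : laplacian A *ᵥ v = 0) (i j : Fin n) : v i = v j := by
  have form_eq_zero := two_mul_dotProduct_laplacian_mulVec hA.symm v
  rw [hv, dotProduct_zero, mul_zero] at form_eq_zero
  have term_nonneg : ∀ i j, 0 ≤ A i j * (v i - v j) ^ 2 :=
    fun i j => mul_nonneg (hA.nonneg i j) (sq_nonneg _)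
  have term_eq_zero : ∀ i j, A i j * (v i - v j) ^ 2 = 0 := fun i j =>
    (Finset.sum_eq_zero_iff_of_nonneg fun j _ => term_nonneg i j).1
      ((Finset.sum_eq_zero_iff_of_nonneg fun i _ => Finset.sum_nonneg fun j _ =>
        term_nonneg i j).1 form_eq_zero.symm i (Finset.mem_univ i)) j (Finset.mem_univ j)
  have eq_of_pos : ∀ {i j}, 0 < A i j → v i = v j := fun {i j} h => by
    simpa [h.ne', sub_eq_zero] using term_eq_zero i j
  have eq_of_adj : ∀ {i j}, (supportGraph A).Adj i j → v i = v j := fun h =>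
    ((SimpleGraph.fromRel_adj _ _ _).1 h).2.elim eq_of_pos fun h' => (eq_of_pos h').symm
  obtain ⟨walk⟩ := hA.connected.preconnected i j
  induction walk with
  | nil => rfl
  | cons adj _ ih => exact (eq_of_adj adj).trans ih

/-- The eigenvalues of the Laplacian, indexed by the agents. -/
def eigenvalue (hA : IsConnectedWeights A) : Fin n → ℝ :=
  (isHermitian_laplacian hA.symm).eigenvalues

/-- An orthonormal basis of eigenvectors of the Laplacian, in the order of `eigenvalue`. -/
def eigenbasis (hA : IsConnectedWeights A) :
    OrthonormalBasis (Fin n) ℝ (EuclideanSpace ℝ (Fin n)) :=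
  (isHermitian_laplacian hA.symm).eigenvectorBasis

/-- The indices of the eigenvectors orthogonal to the consensus direction. -/
def modes (hA : IsConnectedWeights A) : Finset (Fin n) := {j | hA.eigenvalue j ≠ 0}

/-- The component of a family of vectors along the `j`-th eigenvector of the Laplacian. -/
def modeCoeff (hA : IsConnectedWeights A) {E : Type*} [AddCommGroup E] [Module ℝ E] (j : Fin n) :
    (Fin n → E) →ₗ[ℝ] E :=
  weightedSum (hA.eigenbasis j)

variable (hA : IsConnectedWeights A) {j : Fin n}

theorem eigenvalue_mem_spectrum (j : Fin n) : hA.eigenvalue j ∈ spectrum ℝ (laplacian A) :=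
  (isHermitian_laplacian hA.symm).eigenvalues_mem_spectrum_real j

theorem laplacian_mulVec_eigenbasis (j : Fin n) :
    laplacian A *ᵥ hA.eigenbasis j = hA.eigenvalue j • ⇑(hA.eigenbasis j) :=
  (isHermitian_laplacian hA.symm).mulVec_eigenvectorBasis j

theorem eigenvalue_pos (hj : j ∈ hA.modes) : 0 < hA.eigenvalue j :=
  (hA.posSemidef_laplacian.eigenvalues_nonneg j).lt_of_ne' (Finset.mem_filter.1 hj).2

theorem rhoTwo_le_eigenvalue (hj : j ∈ hA.modes) : rhoTwo (laplacian A) ≤ hA.eigenvalue j :=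
  rhoTwo_le_of_mem_spectrum (hA.eigenvalue_pos hj) (hA.eigenvalue_mem_spectrum j)

theorem eigenvalue_le_rho (j : Fin n) : hA.eigenvalue j ≤ rho (laplacian A) :=
  le_rho_of_mem_spectrum (hA.eigenvalue_mem_spectrum j)

theorem modes_nonempty (hn : 2 ≤ n) : hA.modes.Nonempty := by
  by_contra h
  have eigenvalues_eq_zero : (isHermitian_laplacian hA.symm).eigenvalues = 0 := by
    ext j
    by_contra hj
    exact h ⟨j, Finset.mem_filter.2 ⟨Finset.mem_univ j, hj⟩⟩
  have laplacian_eq_zero := (isHermitian_laplacian hA.symm).eigenvalues_eq_zero_iff.1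
    eigenvalues_eq_zero
  have := hA.eq_of_laplacian_mulVec_eq_zero (v := Pi.single ⟨0, by lia⟩ 1)
    (by rw [laplacian_eq_zero, Matrix.zero_mulVec]) ⟨0, by lia⟩ ⟨1, by lia⟩
  simp at this

theorem rhoTwo_laplacian_pos (hA : IsConnectedWeights A) (hn : 2 ≤ n) : 0 < rhoTwo (laplacian A) :=
  let ⟨j, hj⟩ := hA.modes_nonempty hn
  rhoTwo_pos_of_mem_spectrum (hA.eigenvalue_pos hj) (hA.eigenvalue_mem_spectrum j)

theorem rhoTwo_laplacian_le_rho (hA : IsConnectedWeights A) (hn : 2 ≤ n) :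
    rhoTwo (laplacian A) ≤ rho (laplacian A) :=
  let ⟨j, hj⟩ := hA.modes_nonempty hn
  (hA.rhoTwo_le_eigenvalue hj).trans (hA.eigenvalue_le_rho j)

section ModeCoeff

variable {E : Type*}

theorem modeCoeff_matrixAct [AddCommGroup E] [Module ℝ E] (j : Fin n) (x : Fin n → E) :
    hA.modeCoeff j (matrixAct (laplacian A) x) = hA.eigenvalue j • hA.modeCoeff j x :=
  weightedSum_matrixAct (isSymm_laplacian hA.symm) (hA.laplacian_mulVec_eigenbasis j) x

theorem modeCoeff_const [AddCommGroup E] [Module ℝ E] (hj : j ∈ hA.modes) (z : E) :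
    hA.modeCoeff j (fun _ => z) = 0 := by
  have act_const : matrixAct (laplacian A) (fun _ : Fin n => z) = 0 := by
    ext i
    have row := congrFun (laplacian_mulVec_one (A := A)) i
    simp only [Matrix.mulVec, dotProduct, Pi.one_apply, mul_one, Pi.zero_apply] at row
    simp only [matrixAct, ← Finset.sum_smul, row, zero_smul, Pi.zero_apply]
  have := hA.modeCoeff_matrixAct j (fun _ => z)
  rw [act_const, map_zero, eq_comm, smul_eq_zero] at this
  exact this.resolve_left (hA.eigenvalue_pos hj).ne'

theorem modeCoeff_eq_zero_of_sum_eq_zero [AddCommGroup E] [Module ℝ E] (hj : j ∉ hA.modes)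
    {x : Fin n → E} (hx : ∑ i, x i = 0) : hA.modeCoeff j x = 0 := by
  have eigenvalue_eq_zero : hA.eigenvalue j = 0 := by simpa [modes] using hj
  have const : ∀ i, hA.eigenbasis j i = hA.eigenbasis j j := fun i =>
    hA.eq_of_laplacian_mulVec_eq_zero
      (by rw [hA.laplacian_mulVec_eigenbasis, eigenvalue_eq_zero, zero_smul]) i j
  simp only [modeCoeff, weightedSum_apply, const, ← Finset.smul_sum, hx, smul_zero]

theorem sum_norm_sq_modeCoeff {d : ℕ} (x : Fin n → EuclideanSpace ℝ (Fin d)) :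
    ∑ j ∈ hA.modes, ‖hA.modeCoeff j x‖ ^ 2 = disagreement x := by
  have centered : ∀ j, ‖hA.modeCoeff j fun i => x i - avg x‖ ^ 2
      = if j ∈ hA.modes then ‖hA.modeCoeff j x‖ ^ 2 else 0 := fun j => by
    split_ifs with hj
    · rw [show (fun i => x i - avg x) = x - fun _ => avg x from rfl, map_sub,
        hA.modeCoeff_const hj, sub_zero]
    · rw [hA.modeCoeff_eq_zero_of_sum_eq_zero hj (sum_sub_avg x), norm_zero, sq, zero_mul]
  calc ∑ j ∈ hA.modes, ‖hA.modeCoeff j x‖ ^ 2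
      = ∑ j, ‖hA.modeCoeff j fun i => x i - avg x‖ ^ 2 := by
        simp only [centered, Finset.sum_ite_mem, Finset.univ_inter]
    _ = disagreement x := sum_norm_sq_weightedSum hA.eigenbasis _

end ModeCoeff

end IsConnectedWeights

end Laplacian

section Thresholds

variable {ρ ρ₂ ℓ α β γ c ω r δ : ℝ}

theorem epsNine_mem_Ioc (hr : 0 < r) (hδ : δ ∈ Set.Ioc (0 : ℝ) 1) (hω : ω ∈ Set.Ioc 0 (1 / r)) :
    epsNine ω r δ ∈ Set.Ioc 0 (1 / 2) := by
  have hωr : ω * r ≤ 1 := (le_div_iff₀ hr).1 hω.2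
  have hωr₀ : 0 < ω * r := mul_pos hω.1 hr
  unfold epsNine
  constructor
  · have := hδ.1
    positivity
  · linarith [mul_le_one₀ hωr hδ.1.le hδ.2]

theorem epsTen_nonneg (h : epsNine ω r δ ∈ Set.Ioc 0 (1 / 2)) : 0 ≤ epsTen ω r δ := by
  have := inv_pos.2 h.1
  exact mul_nonneg (by linarith [h.2]) (by linarith)

theorem lt_phiTwo' (hρ₂ : 0 ≤ ρ₂) (hρ : ρ₂ ≤ ρ) (hc : 0 ≤ c) :
    4 * c * (ρ * β) ^ 2 < phiTwo' ρ ρ₂ ℓ β γ c := by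
  have hβ : (ρ₂ * β) ^ 2 ≤ (ρ * β) ^ 2 := by
    rw [mul_pow, mul_pow]
    gcongr
  have hργ : 0 ≤ ρ * γ ^ 2 := mul_nonneg (hρ₂.trans hρ) (sq_nonneg γ)
  have hcℓ : 0 ≤ c * ℓ ^ 2 := by positivity
  unfold phiTwo'
  linarith [two_mul_le_add_sq (ρ₂ * β) γ, sq_nonneg (ρ * β), sq_nonneg γ, sq_nonneg ℓ]

theorem phiFour'_pos (hρ : 0 < ρ) (hc : 0 ≤ c) : 0 < phiFour' ρ γ c := by
  unfold phiFour'
  positivity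

theorem phiSix_pos (hℓ : 0 < ℓ) (hρ₂ : 0 < ρ₂) (hβ : 0 < β) (hγ : 0 < γ) :
    0 < phiSix ρ₂ ℓ β γ := by
  unfold phiSix
  positivity

theorem phiSeven_nonneg (hρ : 0 ≤ ρ) (hβ : 0 ≤ β) (hγ : 0 ≤ γ) : 0 ≤ phiSeven ρ β γ := by
  unfold phiSeven
  positivity

theorem phiEight'_pos (hρ₂ : 0 ≤ ρ₂) (hρ : ρ₂ ≤ ρ) (hc : 0 ≤ c) (hβ : 0 ≤ β) (hγ : 0 ≤ γ) :
    0 < phiEight' ρ ρ₂ β γ c := by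
  have h₁ : ρ₂ * β * γ ≤ ρ * β * γ := by gcongr
  have h₂ : 0 ≤ ρ * γ ^ 2 := mul_nonneg (hρ₂.trans hρ) (sq_nonneg γ)
  have h₃ : 0 ≤ c * (ρ * β) ^ 2 := by positivity
  unfold phiEight'
  linarith [two_mul_le_add_sq (ρ * β) γ, sq_nonneg (ρ * β), sq_nonneg γ]

theorem add_lt_of_lt_quadraticRoot {a b ε : ℝ} (ha : 0 < a) (hb : 0 ≤ b) (hα : 0 < α)
    (h : α < (√(b ^ 2 + 8 * ε * a) - b) / (2 * a)) : α * b + α ^ 2 * a < 2 * ε := by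
  rw [lt_div_iff₀ (by positivity), lt_sub_iff_add_lt, Real.lt_sqrt (by positivity)] at h
  refine lt_of_mul_lt_mul_left (a := 4 * a) ?_ (by positivity)
  linarith

/-- The inequalities on the stepsize `α` that drive the descent of the Lyapunov function, the
squared displacement and the compression error entering it with weights `c` and `1`. -/
structure StepsizeConditions (ρ ρ₂ ℓ α β γ c ε₁₂ : ℝ) : Prop where
  stepsize_pos : 0 < α
  gain_pos : 0 < γ
  gain_le : 3 * γ ≤ ρ₂ * β
  displacement_weight_nonneg : 0 ≤ c
  disagreement_coeff : α * phiTwo' ρ ρ₂ ℓ β γ c < phiOne ρ₂ ℓ β γ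
  dual_coeff : α * phiFour' ρ γ c ≤ phiThree ρ₂ γ
  gradient_coeff : α * phiSix ρ₂ ℓ β γ + α * c ≤ phiFive ρ₂ ℓ β γ + 3 / 8
  error_coeff_nonneg : 0 ≤ α * phiSeven ρ β γ + α ^ 2 * phiEight' ρ ρ₂ β γ c
  error_coeff_le : α * phiSeven ρ β γ + α ^ 2 * phiEight' ρ ρ₂ β γ c ≤ 2 * ε₁₂

theorem StepsizeConditions.beta_pos (h : StepsizeConditions ρ ρ₂ ℓ α β γ c ε₁₂) (hρ₂ : 0 < ρ₂) :
    0 < β :=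
  pos_of_mul_pos_right ((mul_pos three_pos h.gain_pos).trans_le h.gain_le) hρ₂.le

theorem stepsizeConditions_of_mem_Ioo (hℓ : 0 < ℓ) (hρ₂ : 0 < ρ₂) (hρ : ρ₂ ≤ ρ) (hγ : 0 < γ)
    (hc : 0 ≤ epsTen ω r δ) (hα : α ∈ Set.Ioo 0 (stepsizeBound ρ ρ₂ ℓ β γ ω r δ)) :
    StepsizeConditions ρ ρ₂ ℓ α β γ (epsTen ω r δ) (epsTwelve ω r δ) := by
  obtain ⟨hα₀, hα⟩ := hα
  simp only [stepsizeBound, lt_min_iff] at hα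
  obtain ⟨⟨h₁₂, h₃₄⟩, h₅₆, h₇₈⟩ := hα
  set c := epsTen ω r δ
  have hρ₀ : 0 < ρ := hρ₂.trans_le hρ
  have two_gt : 4 * c * (ρ * β) ^ 2 < phiTwo' ρ ρ₂ ℓ β γ c := lt_phiTwo' hρ₂.le hρ hc
  have two_pos : 0 < phiTwo' ρ ρ₂ ℓ β γ c := lt_of_le_of_lt (by positivity) two_gt
  rw [lt_div_iff₀ two_pos] at h₁₂
  have one_pos : 0 < phiOne ρ₂ ℓ β γ := (mul_pos hα₀ two_pos).trans h₁₂
  have gain : 3 * γ + 2 + 2 * ℓ ^ 2 < ρ₂ * β := by unfold phiOne at one_pos; linarith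
  have hβ : 0 < β := pos_of_mul_pos_right (lt_trans (by positivity) gain) hρ₂.le
  have weight_le : α * c ≤ 3 / 8 := by
    have one_le : phiOne ρ₂ ℓ β γ ≤ 1 / 2 * (ρ * β) := by
      have : ρ₂ * β ≤ ρ * β := by gcongr
      unfold phiOne
      linarith [sq_nonneg ℓ]
    have two_le : 2 ≤ ρ * β := by
      linarith [sq_nonneg ℓ, mul_le_mul_of_nonneg_right hρ hβ.le]
    have h : α * c * (4 * (ρ * β)) ≤ 1 / 2 := by
      refine le_of_mul_le_mul_right ?_ (mul_pos hρ₀ hβ)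
      linarith [mul_lt_mul_of_pos_left two_gt hα₀]
    linarith [mul_le_mul_of_nonneg_left two_le (mul_nonneg hα₀.le hc)]
  have seven_nonneg := phiSeven_nonneg hρ₀.le hβ.le hγ.le
  have eight_pos := phiEight'_pos hρ₂.le hρ hc hβ.le hγ.le
  exact
    { stepsize_pos := hα₀
      gain_pos := hγ
      gain_le := by linarith [sq_nonneg ℓ]
      displacement_weight_nonneg := hc
      disagreement_coeff := h₁₂
      dual_coeff := ((lt_div_iff₀ (phiFour'_pos hρ₀ hc)).1 h₃₄).le
      gradient_coeff := by linarith [(lt_div_iff₀ (phiSix_pos hℓ hρ₂ hβ hγ)).1 h₅₆]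
      error_coeff_nonneg := by positivity
      error_coeff_le := (add_lt_of_lt_quadraticRoot eight_pos seven_nonneg hα₀ h₇₈).le }

end Thresholds

section Smooth

variable {n d : ℕ} {ℓ : ℝ}

theorem IsSmoothWith.lipschitzWith_gradient {g : EuclideanSpace ℝ (Fin d) → ℝ}
    (hg : IsSmoothWith ℓ g) : LipschitzWith ℓ.toNNReal (gradient g) :=
  LipschitzWith.of_dist_le_mul fun x y => by
    rw [dist_eq_norm, dist_eq_norm]
    exact (hg.2 x y).trans (by gcongr; exact Real.le_coe_toNNReal ℓ)

theorem IsSmoothWith.le_quadratic {g : EuclideanSpace ℝ (Fin d) → ℝ} (hg : IsSmoothWith ℓ g)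
    (x y : EuclideanSpace ℝ (Fin d)) :
    g y ≤ g x + ⟪gradient g x, y - x⟫ + ℓ / 2 * ‖y - x‖ ^ 2 := by
  set gap : ℝ → ℝ := fun t => g (x + t • (y - x)) - t * ⟪gradient g x, y - x⟫
    - t ^ 2 * (ℓ / 2 * ‖y - x‖ ^ 2) with gap_def
  have gap_deriv : ∀ t, HasDerivAt gap (⟪gradient g (x + t • (y - x)), y - x⟫
      - 1 * ⟪gradient g x, y - x⟫ - 2 * t * (ℓ / 2 * ‖y - x‖ ^ 2)) t := fun t => by
    have line : HasDerivAt (fun t : ℝ => x + t • (y - x)) ((1 : ℝ) • (y - x)) t :=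
      ((hasDerivAt_id t).smul_const (y - x)).const_add x
    have along := (hg.1 (x + t • (y - x))).hasFDerivAt.comp_hasDerivAt t line
    rw [one_smul, ← inner_gradient_left] at along
    have square := (hasDerivAt_pow 2 t).mul_const (ℓ / 2 * ‖y - x‖ ^ 2)
    simp only [Nat.cast_ofNat, Nat.add_one_sub_one, pow_one] at square
    exact (along.sub ((hasDerivAt_id t).mul_const _)).sub square
  have gap_anti : AntitoneOn gap (Set.Icc 0 1) := by
    refine antitoneOn_of_deriv_nonpos (convex_Icc 0 1)
      (fun t _ => (gap_deriv t).continuousAt.continuousWithinAt)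
      (fun t _ => (gap_deriv t).differentiableAt.differentiableWithinAt) fun t ht => ?_
    rw [interior_Icc] at ht
    have lipschitz : ⟪gradient g (x + t • (y - x)) - gradient g x, y - x⟫
        ≤ ℓ * (t * ‖y - x‖) * ‖y - x‖ := by
      refine (real_inner_le_norm _ _).trans (mul_le_mul_of_nonneg_right ?_ (norm_nonneg _))
      refine (hg.2 _ _).trans_eq ?_
      rw [add_sub_cancel_left, norm_smul, Real.norm_eq_abs, abs_of_pos ht.1]
    rw [inner_sub_left] at lipschitz
    rw [(gap_deriv t).deriv]
    linarith
  have endpoints := gap_anti (by simp) (by simp) (zero_le_one (α := ℝ))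
  simp only [gap_def, one_smul, zero_smul, add_zero, add_sub_cancel] at endpoints
  linarith

theorem gradient_globalCost {f : Fin n → EuclideanSpace ℝ (Fin d) → ℝ}
    (hf : ∀ i, Differentiable ℝ (f i)) (x : EuclideanSpace ℝ (Fin d)) :
    gradient (globalCost f) x = avg fun i => gradient (f i) x := by
  refine HasGradientAt.gradient (hasGradientAt_iff_hasFDerivAt.2 ?_)
  have toDual_avg : InnerProductSpace.toDual ℝ _ (avg fun i => gradient (f i) x)
      = (n : ℝ)⁻¹ • ∑ i, InnerProductSpace.toDual ℝ _ (gradient (f i) x) := by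
    simp [avg]
  rw [toDual_avg]
  exact (HasFDerivAt.fun_sum (u := Finset.univ)
    fun i _ => (hf i x).hasGradientAt.hasFDerivAt).const_mul (n : ℝ)⁻¹

theorem isSmoothWith_globalCost (hn : n ≠ 0) {f : Fin n → EuclideanSpace ℝ (Fin d) → ℝ}
    (hf : ∀ i, IsSmoothWith ℓ (f i)) : IsSmoothWith ℓ (globalCost f) := by
  refine ⟨(Differentiable.fun_sum fun i _ => (hf i).1).const_mul _, fun x y => ?_⟩
  rw [gradient_globalCost fun i => (hf i).1, gradient_globalCost fun i => (hf i).1]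
  calc ‖avg (fun i => gradient (f i) x) - avg (fun i => gradient (f i) y)‖
      = (n : ℝ)⁻¹ * ‖∑ i, (gradient (f i) x - gradient (f i) y)‖ := by
        rw [← avg_sub, avg, norm_smul, norm_inv, RCLike.norm_natCast]
        rfl
    _ ≤ (n : ℝ)⁻¹ * ∑ _i : Fin n, ℓ * ‖x - y‖ := by
        gcongr
        exact norm_sum_le_of_le _ fun i _ => (hf i).2 x y
    _ = ℓ * ‖x - y‖ := by
        rw [Finset.sum_const, Finset.card_univ, Fintype.card_fin, nsmul_eq_mul,
          inv_mul_cancel_left₀ (Nat.cast_ne_zero.2 hn)]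

/-- The local gradients, each taken at the corresponding agent's own point. -/
def stackedGradient (f : Fin n → EuclideanSpace ℝ (Fin d) → ℝ)
    (x : Fin n → EuclideanSpace ℝ (Fin d)) : Fin n → EuclideanSpace ℝ (Fin d) :=
  fun i => gradient (f i) (x i)

theorem sum_norm_sq_stackedGradient_sub_le {f : Fin n → EuclideanSpace ℝ (Fin d) → ℝ}
    (hf : ∀ i, IsSmoothWith ℓ (f i)) (x y : Fin n → EuclideanSpace ℝ (Fin d)) :
    ∑ i, ‖(stackedGradient f x - stackedGradient f y) i‖ ^ 2
      ≤ ℓ ^ 2 * ∑ i, ‖x i - y i‖ ^ 2 := by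
  rw [Finset.mul_sum]
  refine Finset.sum_le_sum fun i _ => ?_
  rw [← mul_pow]
  exact pow_le_pow_left₀ (norm_nonneg _) ((hf i).2 (x i) (y i)) 2

end Smooth

section Descent

variable {n d : ℕ} {A : Matrix (Fin n) (Fin n) ℝ}
  {f : Fin n → EuclideanSpace ℝ (Fin d) → ℝ} {α β γ ℓ m c ε : ℝ}

/-- The local gradients, all taken at the average of the agents' points. -/
def gradientAtAvg (f : Fin n → EuclideanSpace ℝ (Fin d) → ℝ)
    (x : Fin n → EuclideanSpace ℝ (Fin d)) : Fin n → EuclideanSpace ℝ (Fin d) :=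
  stackedGradient f fun _ => avg x

/-- The dual variable `v` measured from `-γ⁻¹` times the gradients at the average, its equilibrium
value when the agents agree. -/
def shiftedDual (f : Fin n → EuclideanSpace ℝ (Fin d) → ℝ) (γ : ℝ)
    (x v : Fin n → EuclideanSpace ℝ (Fin d)) : Fin n → EuclideanSpace ℝ (Fin d) :=
  v + γ⁻¹ • gradientAtAvg f x

/-- The update of the positions when the graph acts on the estimates `z` of the positions `x`. -/
def primalStep (L : Matrix (Fin n) (Fin n) ℝ) (f : Fin n → EuclideanSpace ℝ (Fin d) → ℝ)
    (α β γ : ℝ) (x v z : Fin n → EuclideanSpace ℝ (Fin d)) :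
    Fin n → EuclideanSpace ℝ (Fin d) :=
  x - α • (β • matrixAct L z + γ • v + stackedGradient f x)

/-- The update of the dual variables when the graph acts on the estimates `z` of the positions. -/
def dualStep (L : Matrix (Fin n) (Fin n) ℝ) (α γ : ℝ)
    (v z : Fin n → EuclideanSpace ℝ (Fin d)) : Fin n → EuclideanSpace ℝ (Fin d) :=
  v + (α * γ) • matrixAct L z

/-- The sum of the energies of all modes: the part of the Lyapunov function that measures how far
the agents are from a consensus equilibrium. -/
def consensusEnergy (hA : IsConnectedWeights A) (f : Fin n → EuclideanSpace ℝ (Fin d) → ℝ)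
    (β γ : ℝ) (x v : Fin n → EuclideanSpace ℝ (Fin d)) : ℝ :=
  ∑ j ∈ hA.modes, modeEnergy β γ (hA.eigenvalue j) (hA.modeCoeff j x)
    (hA.modeCoeff j (shiftedDual f γ x v))

/-- The Lyapunov function of the algorithm without compression, where `m` stands for a lower bound
of the global cost. -/
def lyapunov (hA : IsConnectedWeights A) (f : Fin n → EuclideanSpace ℝ (Fin d) → ℝ) (β γ m : ℝ)
    (x v : Fin n → EuclideanSpace ℝ (Fin d)) : ℝ :=
  consensusEnergy hA f β γ x v + n * (globalCost f (avg x) - m)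

theorem consensusEnergy_nonneg (hA : IsConnectedWeights A) (hγ : 0 < γ)
    (hβ : 0 ≤ β) (hγβ : γ ≤ rhoTwo (laplacian A) * β)
    (x v : Fin n → EuclideanSpace ℝ (Fin d)) : 0 ≤ consensusEnergy hA f β γ x v :=
  Finset.sum_nonneg fun _ hj => modeEnergy_nonneg hγ (hA.eigenvalue_pos hj)
    (hγβ.trans (mul_le_mul_of_nonneg_right (hA.rhoTwo_le_eigenvalue hj) hβ)) _ _

theorem avg_primalStep (hA : A.IsSymm) {v : Fin n → EuclideanSpace ℝ (Fin d)} (hv : ∑ i, v i = 0)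
    (x z : Fin n → EuclideanSpace ℝ (Fin d)) :
    avg (primalStep (laplacian A) f α β γ x v z) = avg x - α • avg (stackedGradient f x) := by
  rw [primalStep, avg_sub, avg_smul]
  congr 2
  simp only [avg, Pi.add_apply, Pi.smul_apply, Finset.sum_add_distrib, ← Finset.smul_sum, hv,
    sum_matrixAct_laplacian hA, smul_zero, zero_add]

theorem modeCoeff_primalStep (hA : IsConnectedWeights A) (hγ : γ ≠ 0) (j : Fin n)
    (x v z : Fin n → EuclideanSpace ℝ (Fin d)) :
    hA.modeCoeff j (primalStep (laplacian A) f α β γ x v z)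
      = hA.modeCoeff j x - α • modeDirection β γ (hA.eigenvalue j) (hA.modeCoeff j x)
          (hA.modeCoeff j (shiftedDual f γ x v)) (hA.modeCoeff j (x - z))
          (hA.modeCoeff j (stackedGradient f x - gradientAtAvg f x)) := by
  simp only [primalStep, modeDirection, shiftedDual, map_add, map_sub, map_smul,
    hA.modeCoeff_matrixAct, sub_sub_cancel, smul_add γ, smul_inv_smul₀ hγ]
  module

theorem modeCoeff_shiftedDual_dualStep (hA : IsConnectedWeights A) (j : Fin n)
    (x v z x' : Fin n → EuclideanSpace ℝ (Fin d)) :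
    hA.modeCoeff j (shiftedDual f γ x' (dualStep (laplacian A) α γ v z))
      = hA.modeCoeff j (shiftedDual f γ x v)
        + (α * γ * hA.eigenvalue j) • (hA.modeCoeff j x - hA.modeCoeff j (x - z))
        + γ⁻¹ • hA.modeCoeff j (gradientAtAvg f x' - gradientAtAvg f x) := by
  simp only [dualStep, shiftedDual, map_add, map_sub, map_smul, hA.modeCoeff_matrixAct,
    sub_sub_cancel, smul_sub, smul_smul]
  abel

theorem consensusEnergy_step_le (hA : IsConnectedWeights A) (hn : 2 ≤ n)
    (hα : StepsizeConditions (rho (laplacian A)) (rhoTwo (laplacian A)) ℓ α β γ c ε)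
    {x v z x' v' : Fin n → EuclideanSpace ℝ (Fin d)}
    (hx' : x' = primalStep (laplacian A) f α β γ x v z)
    (hv' : v' = dualStep (laplacian A) α γ v z) :
    consensusEnergy hA f β γ x' v' + c * disagreement (x' - x)
      ≤ consensusEnergy hA f β γ x v
        - (α * phiOne (rhoTwo (laplacian A)) 0 β γ
          - α ^ 2 * phiTwo' (rho (laplacian A)) (rhoTwo (laplacian A)) 0 β γ c) * disagreement x
        + (α * phiSeven (rho (laplacian A)) β γ
          + α ^ 2 * phiEight' (rho (laplacian A)) (rhoTwo (laplacian A)) β γ c)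
          * disagreement (x - z)
        + (α + α ^ 2 * (5 / 2 + 4 * c)) * disagreement (stackedGradient f x - gradientAtAvg f x)
        + gradDriftCoeff α β γ (rhoTwo (laplacian A))
          * disagreement (gradientAtAvg f x' - gradientAtAvg f x) := by
  have dual_nonneg : 0 ≤ α * phiThree (rhoTwo (laplacian A)) γ
      - α ^ 2 * phiFour' (rho (laplacian A)) γ c := by
    linarith [mul_le_mul_of_nonneg_left hα.dual_coeff hα.stepsize_pos.le]
  simp only [consensusEnergy, ← hA.sum_norm_sq_modeCoeff, Finset.mul_sum,
    ← Finset.sum_add_distrib, ← Finset.sum_sub_distrib]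
  refine Finset.sum_le_sum fun j hj => ?_
  have mode_step := modeEnergy_step_le hα.stepsize_pos hα.gain_pos (hA.rhoTwo_laplacian_pos hn)
    (hA.rhoTwo_le_eigenvalue hj) (hA.eigenvalue_le_rho j) hα.gain_le hα.displacement_weight_nonneg
    (hA.modeCoeff j x) (hA.modeCoeff j (shiftedDual f γ x v)) (hA.modeCoeff j (x - z))
    (hA.modeCoeff j (stackedGradient f x - gradientAtAvg f x))
    (hA.modeCoeff j (gradientAtAvg f x' - gradientAtAvg f x))
  rw [← modeCoeff_primalStep hA hα.gain_pos.ne', ← hx', ← modeCoeff_shiftedDual_dualStep hA, ← hv',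
    ← norm_neg, ← sub_sub_cancel_left (hA.modeCoeff j x),
    ← modeCoeff_primalStep hA hα.gain_pos.ne', ← hx', ← map_sub] at mode_step
  have dual_term := mul_nonneg (div_nonneg dual_nonneg (hA.eigenvalue_pos hj).le)
    (sq_nonneg ‖hA.modeCoeff j (shiftedDual f γ x v)‖)
  linarith

theorem globalCost_sub_smul_le (hn : n ≠ 0) (hf : ∀ i, IsSmoothWith ℓ (f i))
    (x z : EuclideanSpace ℝ (Fin d)) :
    globalCost f (x - α • z) ≤ globalCost f x - α / 2 * ‖gradient (globalCost f) x‖ ^ 2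
      - (α / 2 - ℓ * α ^ 2 / 2) * ‖z‖ ^ 2 + α / 2 * ‖z - gradient (globalCost f) x‖ ^ 2 := by
  have descent := (isSmoothWith_globalCost hn hf).le_quadratic x (x - α • z)
  rw [sub_sub_cancel_left, norm_neg, norm_smul_sq, inner_neg_right, inner_smul_right] at descent
  rw [norm_sub_sq_real, real_inner_comm]
  linarith

theorem sum_norm_sq_gradientAtAvg_sub_le (hf : ∀ i, IsSmoothWith ℓ (f i))
    (x y : Fin n → EuclideanSpace ℝ (Fin d)) :
    ∑ i, ‖(gradientAtAvg f x - gradientAtAvg f y) i‖ ^ 2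
      ≤ ℓ ^ 2 * (n * ‖avg x - avg y‖ ^ 2) := by
  simpa only [gradientAtAvg, Finset.sum_const, Finset.card_univ, Fintype.card_fin, nsmul_eq_mul]
    using sum_norm_sq_stackedGradient_sub_le hf (fun _ => avg x) fun _ => avg y

theorem avg_gradientAtAvg (hf : ∀ i, IsSmoothWith ℓ (f i))
    (x : Fin n → EuclideanSpace ℝ (Fin d)) :
    avg (gradientAtAvg f x) = gradient (globalCost f) (avg x) :=
  (gradient_globalCost (fun i => (hf i).1) _).symm

theorem gradDriftCoeff_mul_eq (hα : α ≠ 0) (ρ₂ : ℝ) :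
    gradDriftCoeff α β γ ρ₂ * (ℓ ^ 2 * α ^ 2)
      = α * (1 / 8 - phiFive ρ₂ ℓ β γ) + α ^ 2 * (phiSix ρ₂ ℓ β γ - ℓ / 2) := by
  unfold gradDriftCoeff phiFive phiSix
  rw [one_div α]
  linear_combination (1 / (2 * γ ^ 2) * (ρ₂ ^ 2)⁻¹ + (β + γ) ^ 2 / γ ^ 5 * ρ₂⁻¹) * ℓ ^ 2 * α
    * inv_mul_cancel₀ hα

theorem gradDriftCoeff_mul_disagreement_le {ρ ρ₂ : ℝ} (hf : ∀ i, IsSmoothWith ℓ (f i))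
    (hα : StepsizeConditions ρ ρ₂ ℓ α β γ c ε) (hρ₂ : 0 < ρ₂)
    (x x' : Fin n → EuclideanSpace ℝ (Fin d)) :
    gradDriftCoeff α β γ ρ₂ * disagreement (gradientAtAvg f x' - gradientAtAvg f x)
      ≤ gradDriftCoeff α β γ ρ₂ * (ℓ ^ 2 * (n * ‖avg x' - avg x‖ ^ 2)) :=
  mul_le_mul_of_nonneg_left ((disagreement_le_sum_norm_sq _).trans
    (sum_norm_sq_gradientAtAvg_sub_le hf x' x))
    (gradDriftCoeff_nonneg hα.stepsize_pos (hα.beta_pos hρ₂) hα.gain_pos hρ₂)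

theorem lyapunov_step_le (hA : IsConnectedWeights A) (hn : 2 ≤ n)
    (hf : ∀ i, IsSmoothWith ℓ (f i))
    (hα : StepsizeConditions (rho (laplacian A)) (rhoTwo (laplacian A)) ℓ α β γ c ε)
    {x v z x' v' : Fin n → EuclideanSpace ℝ (Fin d)} (hv : ∑ i, v i = 0)
    (hx' : x' = primalStep (laplacian A) f α β γ x v z)
    (hv' : v' = dualStep (laplacian A) α γ v z) :
    lyapunov hA f β γ m x' v' + c * ∑ i, ‖x' i - x i‖ ^ 2
      ≤ lyapunov hA f β γ m x v
        - (α * phiOne (rhoTwo (laplacian A)) ℓ β γ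
          - α ^ 2 * phiTwo' (rho (laplacian A)) (rhoTwo (laplacian A)) ℓ β γ c) * disagreement x
        - α / 2 * (n * ‖gradient (globalCost f) (avg x)‖ ^ 2)
        + (α * phiSeven (rho (laplacian A)) β γ
          + α ^ 2 * phiEight' (rho (laplacian A)) (rhoTwo (laplacian A)) β γ c)
          * ∑ i, ‖x i - z i‖ ^ 2 := by
  set ρ := rho (laplacian A)
  set ρ₂ := rhoTwo (laplacian A)
  set g := avg (stackedGradient f x)
  set g₀ := gradient (globalCost f) (avg x)
  have hα₀ := hα.stepsize_pos
  have hc := hα.displacement_weight_nonneg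
  have hρ₂ : 0 < ρ₂ := hA.rhoTwo_laplacian_pos hn
  have avg_step : avg x' = avg x - α • g := hx' ▸ avg_primalStep hA.symm hv x z
  have avg_move : ‖avg x' - avg x‖ ^ 2 = α ^ 2 * ‖g‖ ^ 2 := by
    rw [avg_step, sub_sub_cancel_left, norm_neg, norm_smul_sq]
  have avg_mismatch : avg (stackedGradient f x - gradientAtAvg f x) = g - g₀ := by
    rw [avg_sub, avg_gradientAtAvg hf]
  have consensus := consensusEnergy_step_le hA hn (f := f) hα hx' hv'
  have compression : (α * phiSeven ρ β γ + α ^ 2 * phiEight' ρ ρ₂ β γ c) * disagreement (x - z)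
      ≤ (α * phiSeven ρ β γ + α ^ 2 * phiEight' ρ ρ₂ β γ c) * ∑ i, ‖x i - z i‖ ^ 2 :=
    mul_le_mul_of_nonneg_left (disagreement_le_sum_norm_sq (x - z)) hα.error_coeff_nonneg
  have displacement : ∑ i, ‖x' i - x i‖ ^ 2
      = disagreement (x' - x) + n * (α ^ 2 * ‖g‖ ^ 2) := by
    rw [← avg_move, ← avg_sub]
    exact sum_norm_sq_eq_disagreement_add (x' - x)
  have mismatch : disagreement (stackedGradient f x - gradientAtAvg f x) + n * ‖g - g₀‖ ^ 2
      ≤ ℓ ^ 2 * disagreement x := by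
    rw [← avg_mismatch, ← sum_norm_sq_eq_disagreement_add]
    exact sum_norm_sq_stackedGradient_sub_le hf x fun _ => avg x
  have drift := gradDriftCoeff_mul_disagreement_le hf hα hρ₂ x x'
  rw [avg_move] at drift
  have cost := globalCost_sub_smul_le (α := α) (by lia : n ≠ 0) hf (avg x) g
  rw [← avg_step] at cost
  have scaled_cost := mul_le_mul_of_nonneg_left cost (Nat.cast_nonneg (α := ℝ) n)
  have gradient_term := mul_le_mul_of_nonneg_right
    (mul_le_mul_of_nonneg_left hα.gradient_coeff hα₀.le) (by positivity : 0 ≤ n * ‖g‖ ^ 2)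
  have scaled_mismatch := mul_le_mul_of_nonneg_left mismatch
    (by positivity : 0 ≤ α + α ^ 2 * (5 / 2 + 4 * c))
  have slack : 0 ≤ (α / 2 + α ^ 2 * (5 / 2 + 4 * c)) * (n * ‖g - g₀‖ ^ 2) := by positivity
  rw [displacement]
  unfold lyapunov phiOne phiTwo'
  unfold phiOne phiTwo' at consensus
  linear_combination consensus + compression + scaled_cost + drift + gradient_term
    + scaled_mismatch + slack
    + n * ‖g‖ ^ 2 * gradDriftCoeff_mul_eq (ℓ := ℓ) (β := β) (γ := γ) hα₀.ne' ρ₂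

theorem le_lyapunov (hA : IsConnectedWeights A) (hn : 2 ≤ n)
    (hα : StepsizeConditions (rho (laplacian A)) (rhoTwo (laplacian A)) ℓ α β γ c ε)
    (x v : Fin n → EuclideanSpace ℝ (Fin d)) :
    n * (globalCost f (avg x) - m) ≤ lyapunov hA f β γ m x v :=
  le_add_of_nonneg_left (consensusEnergy_nonneg hA hα.gain_pos
    (hα.beta_pos (hA.rhoTwo_laplacian_pos hn)).le (by linarith [hα.gain_le, hα.gain_pos]) x v)

end Descent

section Integrability

variable {n d : ℕ} {Ω : Type*} [MeasurableSpace Ω] {μ : Measure Ω} {ℓ m : ℝ}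

theorem integrable_inner_of_memLp {E : Type*} [NormedAddCommGroup E] [InnerProductSpace ℝ E]
    {Y Z : Ω → E} (hY : MemLp Y 2 μ) (hZ : MemLp Z 2 μ) :
    Integrable (fun w => ⟪Y w, Z w⟫) μ :=
  (hY.norm.integrable_mul hZ.norm).mono' (hY.1.inner hZ.1)
    (Eventually.of_forall fun w => norm_inner_le_norm (Y w) (Z w))

theorem integrable_modeEnergy {E : Type*} [NormedAddCommGroup E] [InnerProductSpace ℝ E]
    (β γ l : ℝ) {Y Z : Ω → E} (hY : MemLp Y 2 μ) (hZ : MemLp Z 2 μ) :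
    Integrable (fun w => modeEnergy β γ l (Y w) (Z w)) μ :=
  (((hY.integrable_norm_pow two_ne_zero).const_mul _).add
    ((integrable_inner_of_memLp hY hZ).const_mul _)).add
    ((hZ.integrable_norm_pow two_ne_zero).const_mul _)

theorem memLp_avg {p : ℝ≥0∞} {X : Ω → Fin n → EuclideanSpace ℝ (Fin d)} (hX : MemLp X p μ) :
    MemLp (fun w => avg (X w)) p μ :=
  (memLp_finsetSum Finset.univ fun i _ => hX.eval i).const_smul (n : ℝ)⁻¹

theorem memLp_matrixAct {p : ℝ≥0∞} {X : Ω → Fin n → EuclideanSpace ℝ (Fin d)}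
    (hX : MemLp X p μ) (M : Matrix (Fin n) (Fin n) ℝ) :
    MemLp (fun w => matrixAct M (X w)) p μ :=
  .of_eval fun i => memLp_finsetSum Finset.univ fun k _ => (hX.eval k).const_smul (M i k)

theorem integrable_disagreement {X : Ω → Fin n → EuclideanSpace ℝ (Fin d)} (hX : MemLp X 2 μ) :
    Integrable (fun w => disagreement (X w)) μ :=
  integrable_finsetSum _ fun i _ =>
    ((hX.eval i).sub (memLp_avg hX)).integrable_norm_pow two_ne_zero

/-- The mean squared distance between two random families of vectors, summed over the agents. -/
def meanSqDist (μ : Measure Ω) (X Z : Ω → Fin n → EuclideanSpace ℝ (Fin d)) : ℝ :=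
  ∫ w, ∑ i, ‖X w i - Z w i‖ ^ 2 ∂μ

theorem meanSqDist_nonneg (X Z : Ω → Fin n → EuclideanSpace ℝ (Fin d)) :
    0 ≤ meanSqDist μ X Z :=
  integral_nonneg fun _ => Finset.sum_nonneg fun _ _ => sq_nonneg _

section MeanSqDist

variable {X Y Z : Ω → Fin n → EuclideanSpace ℝ (Fin d)}

theorem integrable_sum_norm_sub_sq (hX : MemLp X 2 μ) (hZ : MemLp Z 2 μ) :
    Integrable (fun w => ∑ i, ‖X w i - Z w i‖ ^ 2) μ :=
  integrable_finsetSum _ fun i _ => ((hX.eval i).sub (hZ.eval i)).integrable_norm_pow two_ne_zero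

theorem meanSqDist_eq_sum (hX : MemLp X 2 μ) (hZ : MemLp Z 2 μ) :
    meanSqDist μ X Z = ∑ i, ∫ w, ‖X w i - Z w i‖ ^ 2 ∂μ :=
  integral_finsetSum _ fun i _ => ((hX.eval i).sub (hZ.eval i)).integrable_norm_pow two_ne_zero

theorem meanSqDist_le_weighted {c : ℝ} (hc : 0 < c) (hX : MemLp X 2 μ) (hY : MemLp Y 2 μ)
    (hZ : MemLp Z 2 μ) :
    meanSqDist μ X Z ≤ (1 + c) * meanSqDist μ Y Z + (1 + c⁻¹) * meanSqDist μ X Y := by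
  have hYZ := (integrable_sum_norm_sub_sq hY hZ).const_mul (1 + c)
  have hXY := (integrable_sum_norm_sub_sq hX hY).const_mul (1 + c⁻¹)
  rw [meanSqDist, meanSqDist, meanSqDist, ← integral_const_mul, ← integral_const_mul,
    ← integral_add hYZ hXY]
  refine integral_mono (integrable_sum_norm_sub_sq hX hZ) (hYZ.add hXY) fun w => ?_
  simp only [Finset.mul_sum, ← Finset.sum_add_distrib]
  refine Finset.sum_le_sum fun i _ => ?_
  rw [← sub_add_sub_cancel' (Y w i) (Z w i) (X w i)]
  exact norm_add_sq_le_weighted hc _ _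

end MeanSqDist

variable [IsFiniteMeasure μ]

theorem IsSmoothWith.memLp_gradient {p : ℝ≥0∞} {g : EuclideanSpace ℝ (Fin d) → ℝ}
    (hg : IsSmoothWith ℓ g) {Y : Ω → EuclideanSpace ℝ (Fin d)} (hY : MemLp Y p μ) :
    MemLp (fun w => gradient g (Y w)) p μ := by
  have centered : MemLp (fun w => gradient g (Y w) - gradient g 0) p μ :=
    (hg.lipschitzWith_gradient.sub (LipschitzWith.const (gradient g 0))).comp_memLp
      (sub_self _) hY
  simpa only [Pi.add_def, sub_add_cancel] using centered.add (memLp_const (gradient g 0))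

theorem memLp_stackedGradient {p : ℝ≥0∞} {f : Fin n → EuclideanSpace ℝ (Fin d) → ℝ}
    (hf : ∀ i, IsSmoothWith ℓ (f i)) {X : Ω → Fin n → EuclideanSpace ℝ (Fin d)}
    (hX : MemLp X p μ) : MemLp (fun w => stackedGradient f (X w)) p μ :=
  .of_eval fun i => (hf i).memLp_gradient (hX.eval i)

theorem IsSmoothWith.integrable_sub_const {g : EuclideanSpace ℝ (Fin d) → ℝ}
    (hg : IsSmoothWith ℓ g) (hm : ∀ z, m ≤ g z) {Y : Ω → EuclideanSpace ℝ (Fin d)}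
    (hY : MemLp Y 2 μ) : Integrable (fun w => g (Y w) - m) μ := by
  have majorant : Integrable (fun w => g 0 - m + ⟪gradient g 0, Y w⟫ + ℓ / 2 * ‖Y w‖ ^ 2) μ :=
    ((integrable_const _).add (integrable_inner_of_memLp (memLp_const _) hY)).add
      ((hY.integrable_norm_pow two_ne_zero).const_mul _)
  refine majorant.mono' ((hg.1.continuous.comp_aestronglyMeasurable hY.1).sub
    aestronglyMeasurable_const) (Eventually.of_forall fun w => ?_)
  have quadratic := hg.le_quadratic 0 (Y w)
  rw [sub_zero] at quadratic
  rw [Real.norm_eq_abs, abs_of_nonneg (sub_nonneg.2 (hm _))]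
  linarith

theorem integrable_lyapunov {A : Matrix (Fin n) (Fin n) ℝ} (hA : IsConnectedWeights A)
    (hn : n ≠ 0) {f : Fin n → EuclideanSpace ℝ (Fin d) → ℝ} (hf : ∀ i, IsSmoothWith ℓ (f i))
    (hm : ∀ z, m ≤ globalCost f z) (β γ : ℝ)
    {X V : Ω → Fin n → EuclideanSpace ℝ (Fin d)} (hX : MemLp X 2 μ) (hV : MemLp V 2 μ) :
    Integrable (fun w => lyapunov hA f β γ m (X w) (V w)) μ := by
  have modeCoeff_memLp : ∀ j, ∀ {Y : Ω → Fin n → EuclideanSpace ℝ (Fin d)}, MemLp Y 2 μ →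
      MemLp (fun w => hA.modeCoeff j (Y w)) 2 μ :=
    fun j _ hY =>
      (LinearMap.toContinuousLinearMap (hA.modeCoeff (E := EuclideanSpace ℝ (Fin d)) j)).comp_memLp'
        hY
  have shiftedDual_memLp : MemLp (fun w => shiftedDual f γ (X w) (V w)) 2 μ :=
    hV.add ((memLp_stackedGradient hf (.of_eval fun _ => memLp_avg hX)).const_smul γ⁻¹)
  exact (integrable_finsetSum _ fun j _ => integrable_modeEnergy _ _ _ (modeCoeff_memLp j hX)
    (modeCoeff_memLp j shiftedDual_memLp)).add
    (((isSmoothWith_globalCost hn hf).integrable_sub_const hm (memLp_avg hX)).const_mul _)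

end Integrability

section Compression

variable {d : ℕ} {Ω Ξ : Type*} [MeasurableSpace Ω] [MeasurableSpace Ξ]
  {μ : Measure Ω} {ν : Measure Ξ} {𝒞 : Ξ → EuclideanSpace ℝ (Fin d) → EuclideanSpace ℝ (Fin d)}
  {r δ C ω s : ℝ}

/-- The error made when the input `z` is recovered from its compression by dividing by `r`. -/
def compressionResidual (𝒞 : Ξ → EuclideanSpace ℝ (Fin d) → EuclideanSpace ℝ (Fin d)) (r : ℝ)
    (ζ : Ξ) (z : EuclideanSpace ℝ (Fin d)) : EuclideanSpace ℝ (Fin d) :=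
  r⁻¹ • 𝒞 ζ z - z

namespace IsGloballyBounded

theorem measurable_residual (h𝒞 : IsGloballyBounded ν 𝒞 r δ C) :
    Measurable fun p : EuclideanSpace ℝ (Fin d) × Ξ => compressionResidual 𝒞 r p.2 p.1 :=
  ((h𝒞.measurable.comp measurable_swap).const_smul r⁻¹).sub measurable_fst

theorem integrable_prod [SFinite ν] (h𝒞 : IsGloballyBounded ν 𝒞 r δ C)
    {κ : Measure (EuclideanSpace ℝ (Fin d))} [IsFiniteMeasure κ]
    (hκ : Integrable (fun z => ‖z‖ ^ 2) κ) :
    Integrable (fun p => ‖compressionResidual 𝒞 r p.2 p.1‖ ^ 2) (κ.prod ν) := by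
  have residual_measurable := h𝒞.measurable_residual.norm.pow_const 2
  refine (integrable_prod_iff residual_measurable.aestronglyMeasurable).2
    ⟨Eventually.of_forall h𝒞.integrable,
      ((hκ.const_mul (1 - δ)).add (integrable_const C)).mono'
        residual_measurable.norm.stronglyMeasurable.integral_prod_right.aestronglyMeasurable
        (Eventually.of_forall fun z => ?_)⟩
  rw [Real.norm_eq_abs, abs_of_nonneg (integral_nonneg fun _ => norm_nonneg _)]
  simp only [norm_pow, norm_norm]
  exact h𝒞.bound z

theorem integral_prod_le [SFinite ν] (h𝒞 : IsGloballyBounded ν 𝒞 r δ C)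
    {κ : Measure (EuclideanSpace ℝ (Fin d))} [IsProbabilityMeasure κ]
    (hκ : Integrable (fun z => ‖z‖ ^ 2) κ) :
    ∫ p, ‖compressionResidual 𝒞 r p.2 p.1‖ ^ 2 ∂(κ.prod ν) ≤ (1 - δ) * ∫ z, ‖z‖ ^ 2 ∂κ + C :=
  calc ∫ p, ‖compressionResidual 𝒞 r p.2 p.1‖ ^ 2 ∂(κ.prod ν)
      = ∫ z, ∫ ζ, ‖compressionResidual 𝒞 r ζ z‖ ^ 2 ∂ν ∂κ :=
        integral_prod _ (h𝒞.integrable_prod hκ)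
    _ ≤ ∫ z, ((1 - δ) * ‖z‖ ^ 2 + C) ∂κ :=
        integral_mono (h𝒞.integrable_prod hκ).integral_prod_left
          ((hκ.const_mul _).add (integrable_const _)) h𝒞.bound
    _ = (1 - δ) * ∫ z, ‖z‖ ^ 2 ∂κ + C := by
        rw [integral_add (hκ.const_mul _) (integrable_const _), integral_const_mul,
          integral_const, probReal_univ, one_smul]

variable [IsProbabilityMeasure μ] {ζ : Ω → Ξ}

theorem memLp_residual_and_integral_le (h𝒞 : IsGloballyBounded ν 𝒞 r δ C)
    {Z : Ω → EuclideanSpace ℝ (Fin d)} (hZm : Measurable Z) (hZ : MemLp Z 2 μ)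
    (hζ : Measurable ζ) (hlaw : μ.map ζ = ν) (hind : IndepFun Z ζ μ) :
    MemLp (fun w => compressionResidual 𝒞 r (ζ w) (Z w)) 2 μ ∧
      ∫ w, ‖compressionResidual 𝒞 r (ζ w) (Z w)‖ ^ 2 ∂μ
        ≤ (1 - δ) * ∫ w, ‖Z w‖ ^ 2 ∂μ + C := by
  have joint_law : μ.map (fun w => (Z w, ζ w)) = (μ.map Z).prod ν := by
    rw [(indepFun_iff_map_prod_eq_prod_map_map hZm.aemeasurable hζ.aemeasurable).1 hind, hlaw]
  have : IsProbabilityMeasure (μ.map Z) := Measure.isProbabilityMeasure_map hZm.aemeasurable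
  have : IsProbabilityMeasure ν := hlaw ▸ Measure.isProbabilityMeasure_map hζ.aemeasurable
  have pair_measurable : Measurable fun w => (Z w, ζ w) := hZm.prodMk hζ
  have residual_measurable := h𝒞.measurable_residual.norm.pow_const 2
  have hκ : Integrable (fun z => ‖z‖ ^ 2) (μ.map Z) :=
    (integrable_map_measure (by fun_prop) hZm.aemeasurable).2
      (hZ.integrable_norm_pow two_ne_zero)
  refine ⟨(memLp_two_iff_integrable_sq_norm
    (h𝒞.measurable_residual.comp pair_measurable).aestronglyMeasurable).2 ?_, ?_⟩
  · have := h𝒞.integrable_prod hκ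
    rwa [← joint_law, integrable_map_measure residual_measurable.aestronglyMeasurable
      pair_measurable.aemeasurable] at this
  · have := h𝒞.integral_prod_le hκ
    rwa [← joint_law, integral_map pair_measurable.aemeasurable
      residual_measurable.aestronglyMeasurable, integral_map hZm.aemeasurable (by fun_prop)]
      at this

variable {D : Ω → EuclideanSpace ℝ (Fin d)}

theorem memLp_compress (h𝒞 : IsGloballyBounded ν 𝒞 r δ C) (hr : r ≠ 0)
    (hDm : Measurable D) (hD : MemLp D 2 μ) (hζ : Measurable ζ) (hlaw : μ.map ζ = ν)
    (hind : IndepFun D ζ μ) (s : ℝ) : MemLp (fun w => 𝒞 (ζ w) (s⁻¹ • D w)) 2 μ := by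
  have residual := (h𝒞.memLp_residual_and_integral_le (hDm.const_smul s⁻¹) (hD.const_smul s⁻¹) hζ
    hlaw (hind.comp (measurable_const_smul s⁻¹) measurable_id)).1
  simpa only [compressionResidual, Pi.smul_def, Pi.add_def, sub_add_cancel, smul_inv_smul₀ hr]
    using (residual.add (hD.const_smul s⁻¹)).const_smul r

end IsGloballyBounded

theorem norm_sub_smul_sq_le {E : Type*} [NormedAddCommGroup E] [InnerProductSpace ℝ E]
    (hr : 0 < r) (hω : ω ∈ Set.Ioc 0 (1 / r)) (hs : s ≠ 0) (z q : E) :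
    ‖z - (ω * s) • q‖ ^ 2
      ≤ (1 - ω * r) * ‖z‖ ^ 2 + ω * r * (s ^ 2 * ‖r⁻¹ • q - s⁻¹ • z‖ ^ 2) := by
  have combination : z - (ω * s) • q
      = (1 - ω * r) • z + (ω * r) • ((-s) • (r⁻¹ • q - s⁻¹ • z)) := by
    match_scalars
    · field_simp
      ring
    · field_simp
  rw [combination, ← neg_sq s, ← norm_smul_sq]
  exact (convexOn_univ_norm.pow (fun _ _ => norm_nonneg _) 2).2 trivial trivial
    (sub_nonneg.2 ((le_div_iff₀ hr).1 hω.2)) (mul_pos hω.1 hr).le (sub_add_cancel _ _)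

theorem IsGloballyBounded.integral_norm_sq_sub_compress_le [IsProbabilityMeasure μ]
    (h𝒞 : IsGloballyBounded ν 𝒞 r δ C) (hr : 0 < r) (hω : ω ∈ Set.Ioc 0 (1 / r)) (hs : s ≠ 0)
    {D : Ω → EuclideanSpace ℝ (Fin d)} {ζ : Ω → Ξ} (hDm : Measurable D) (hD : MemLp D 2 μ)
    (hζ : Measurable ζ) (hlaw : μ.map ζ = ν) (hind : IndepFun D ζ μ) :
    ∫ w, ‖D w - (ω * s) • 𝒞 (ζ w) (s⁻¹ • D w)‖ ^ 2 ∂μ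
      ≤ (1 - ω * r * δ) * ∫ w, ‖D w‖ ^ 2 ∂μ + ω * r * C * s ^ 2 := by
  obtain ⟨residual, residual_le⟩ := h𝒞.memLp_residual_and_integral_le (hDm.const_smul s⁻¹)
    (hD.const_smul s⁻¹) hζ hlaw (hind.comp (measurable_const_smul s⁻¹) measurable_id)
  simp only [Pi.smul_apply] at residual residual_le
  have hDi := hD.integrable_norm_pow two_ne_zero
  have hRi := residual.integrable_norm_pow two_ne_zero
  have scaled : s ^ 2 * ∫ w, ‖s⁻¹ • D w‖ ^ 2 ∂μ = ∫ w, ‖D w‖ ^ 2 ∂μ := by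
    simp only [norm_smul_sq, integral_const_mul]
    field_simp
  calc ∫ w, ‖D w - (ω * s) • 𝒞 (ζ w) (s⁻¹ • D w)‖ ^ 2 ∂μ
      ≤ ∫ w, ((1 - ω * r) * ‖D w‖ ^ 2
          + ω * r * (s ^ 2 * ‖compressionResidual 𝒞 r (ζ w) (s⁻¹ • D w)‖ ^ 2)) ∂μ :=
        integral_mono
          ((hD.sub ((h𝒞.memLp_compress hr.ne' hDm hD hζ hlaw hind s).const_smul
            (ω * s))).integrable_norm_pow two_ne_zero)
          ((hDi.const_mul _).add ((hRi.const_mul _).const_mul _))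
          fun w => norm_sub_smul_sq_le hr hω hs _ _
    _ = (1 - ω * r) * ∫ w, ‖D w‖ ^ 2 ∂μ
          + ω * r * (s ^ 2 * ∫ w, ‖compressionResidual 𝒞 r (ζ w) (s⁻¹ • D w)‖ ^ 2 ∂μ) := by
        rw [integral_add (hDi.const_mul _) ((hRi.const_mul _).const_mul _), integral_const_mul,
          integral_const_mul, integral_const_mul]
    _ ≤ (1 - ω * r) * ∫ w, ‖D w‖ ^ 2 ∂μ
          + ω * r * (s ^ 2 * ((1 - δ) * ∫ w, ‖s⁻¹ • D w‖ ^ 2 ∂μ + C)) := by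
        have := mul_pos hω.1 hr
        gcongr
    _ = (1 - ω * r * δ) * ∫ w, ‖D w‖ ^ 2 ∂μ + ω * r * C * s ^ 2 := by
        rw [mul_add (s ^ 2), mul_left_comm (s ^ 2), scaled]
        ring

end Compression

section Run

variable {n d : ℕ} {Ω Ξ : Type*} {L : Matrix (Fin n) (Fin n) ℝ}
  {f : Fin n → EuclideanSpace ℝ (Fin d) → ℝ}
  {𝒞 : Ξ → EuclideanSpace ℝ (Fin d) → EuclideanSpace ℝ (Fin d)}
  {α β γ ω ℓ r δ C : ℝ} {s : ℕ → ℝ} {x0 : Fin n → EuclideanSpace ℝ (Fin d)}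

section Updates

variable {mΩ : MeasurableSpace Ω} {μ : Measure Ω} {X V Z : Ω → Fin n → EuclideanSpace ℝ (Fin d)}

theorem measurable_matrixAct (M : Matrix (Fin n) (Fin n) ℝ) :
    Measurable (matrixAct M : (Fin n → EuclideanSpace ℝ (Fin d)) → _) :=
  measurable_pi_lambda _ fun i =>
    Finset.measurable_fun_sum _ fun k _ => (measurable_pi_apply k).const_smul (M i k)

theorem measurable_stackedGradient (hf : ∀ i, IsSmoothWith ℓ (f i)) :
    Measurable (stackedGradient f) :=
  measurable_pi_lambda _ fun i =>
    (hf i).lipschitzWith_gradient.continuous.measurable.comp (measurable_pi_apply i)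

theorem measurable_primalStep (hf : ∀ i, IsSmoothWith ℓ (f i)) (hX : Measurable X)
    (hV : Measurable V) (hZ : Measurable Z) :
    Measurable fun w => primalStep L f α β γ (X w) (V w) (Z w) :=
  hX.sub ((((((measurable_matrixAct L).comp hZ).const_smul β).add (hV.const_smul γ)).add
    ((measurable_stackedGradient hf).comp hX)).const_smul α)

theorem measurable_dualStep (hV : Measurable V) (hZ : Measurable Z) :
    Measurable fun w => dualStep L α γ (V w) (Z w) :=
  hV.add (((measurable_matrixAct L).comp hZ).const_smul (α * γ))

theorem memLp_primalStep [IsFiniteMeasure μ] (hf : ∀ i, IsSmoothWith ℓ (f i)) {p : ℝ≥0∞}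
    (hX : MemLp X p μ) (hV : MemLp V p μ) (hZ : MemLp Z p μ) :
    MemLp (fun w => primalStep L f α β γ (X w) (V w) (Z w)) p μ :=
  hX.sub (((((memLp_matrixAct hZ L).const_smul β).add (hV.const_smul γ)).add
    (memLp_stackedGradient hf hX)).const_smul α)

theorem memLp_dualStep {p : ℝ≥0∞} (hV : MemLp V p μ) (hZ : MemLp Z p μ) :
    MemLp (fun w => dualStep L α γ (V w) (Z w)) p μ :=
  hV.add ((memLp_matrixAct hZ L).const_smul (α * γ))

end Updates

/-- The random states `S k` at the start of each iteration `k` form the run of the algorithm from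
`x0` driven by the internal randomness `ξ`. -/
def IsRandomRun (L : Matrix (Fin n) (Fin n) ℝ) (f : Fin n → EuclideanSpace ℝ (Fin d) → ℝ)
    (𝒞 : Ξ → EuclideanSpace ℝ (Fin d) → EuclideanSpace ℝ (Fin d)) (α β γ ω : ℝ) (s : ℕ → ℝ)
    (x0 : Fin n → EuclideanSpace ℝ (Fin d)) (ξ : ℕ → Fin n → Ω → Ξ) (S : ℕ → Ω → State n d) :
    Prop :=
  ∀ k w, S k w = run L f 𝒞 α β γ ω s x0 (fun j i => ξ j i w) k

namespace IsRandomRun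

variable {ξ : ℕ → Fin n → Ω → Ξ} {S : ℕ → Ω → State n d}

theorem xhat_succ (hS : IsRandomRun L f 𝒞 α β γ ω s x0 ξ S) (k : ℕ) (w : Ω) (i : Fin n) :
    (S (k + 1) w).xhat i = (S k w).xhat i
      + (ω * s k) • 𝒞 (ξ k i w) ((s k)⁻¹ • ((S k w).x i - (S k w).xhat i)) := by
  rw [hS (k + 1), hS k]
  rfl

theorem y_succ (hS : IsRandomRun L f 𝒞 α β γ ω s x0 ξ S) (k : ℕ) (w : Ω) :
    (S (k + 1) w).y = (S k w).y
      + (ω * s k) • matrixAct L (message 𝒞 (s k) (fun i => ξ k i w) (S k w)) := by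
  rw [hS (k + 1), hS k]
  rfl

theorem y_eq (hS : IsRandomRun L f 𝒞 α β γ ω s x0 ξ S) (k : ℕ) (w : Ω) :
    (S k w).y = matrixAct L (S k w).xhat := by
  induction k with
  | zero =>
    rw [hS 0]
    funext i
    simp only [run, matrixAct, Pi.zero_apply, smul_zero, Finset.sum_const_zero]
  | succ k ih =>
    have xhat_succ : (S (k + 1) w).xhat
        = (S k w).xhat + (ω * s k) • message 𝒞 (s k) (fun i => ξ k i w) (S k w) :=
      funext (hS.xhat_succ k w)
    rw [hS.y_succ, ih, xhat_succ, matrixAct_add, matrixAct_smul]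

theorem x_succ (hS : IsRandomRun L f 𝒞 α β γ ω s x0 ξ S) (k : ℕ) (w : Ω) :
    (S (k + 1) w).x = primalStep L f α β γ (S k w).x (S k w).v (S (k + 1) w).xhat := by
  rw [primalStep, ← hS.y_eq, hS (k + 1), hS k]
  rfl

theorem v_succ (hS : IsRandomRun L f 𝒞 α β γ ω s x0 ξ S) (k : ℕ) (w : Ω) :
    (S (k + 1) w).v = dualStep L α γ (S k w).v (S (k + 1) w).xhat := by
  rw [dualStep, ← hS.y_eq, hS (k + 1), hS k]
  rfl

theorem sum_v {A : Matrix (Fin n) (Fin n) ℝ} (hA : A.IsSymm)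
    (hS : IsRandomRun (laplacian A) f 𝒞 α β γ ω s x0 ξ S) (k : ℕ) (w : Ω) :
    ∑ i, (S k w).v i = 0 := by
  induction k with
  | zero =>
    rw [hS 0]
    exact Finset.sum_const_zero
  | succ k ih =>
    simp only [hS.v_succ, dualStep, Pi.add_apply, Pi.smul_apply, Finset.sum_add_distrib, ih,
      ← Finset.smul_sum, sum_matrixAct_laplacian hA, smul_zero, add_zero]

theorem measurable_state {mΩ : MeasurableSpace Ω} [MeasurableSpace Ξ]
    (hS : IsRandomRun L f 𝒞 α β γ ω s x0 ξ S) (h𝒞 : Measurable (Function.uncurry 𝒞))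
    (hf : ∀ i, IsSmoothWith ℓ (f i)) (k : ℕ) (hξ : ∀ j < k, ∀ i, Measurable (ξ j i)) :
    Measurable (fun w => (S k w).x) ∧ Measurable (fun w => (S k w).v) ∧
      Measurable (fun w => (S k w).xhat) := by
  induction k with
  | zero =>
    simp only [hS 0]
    exact ⟨measurable_const, measurable_const, measurable_const⟩
  | succ k ih =>
    obtain ⟨hX, hV, hZ⟩ := ih fun j hj => hξ j (hj.trans k.lt_succ_self)
    have hZ' : Measurable fun w => (S (k + 1) w).xhat := by
      refine measurable_pi_lambda _ fun i => ?_
      simp only [hS.xhat_succ]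
      have hXi := measurable_pi_iff.1 hX i
      have hZi := measurable_pi_iff.1 hZ i
      exact hZi.add ((h𝒞.comp ((hξ k k.lt_succ_self i).prodMk
        ((hXi.sub hZi).const_smul (s k)⁻¹))).const_smul (ω * s k))
    refine ⟨?_, ?_, hZ'⟩
    · simp only [hS.x_succ]
      exact measurable_primalStep hf hX hV hZ'
    · simp only [hS.v_succ]
      exact measurable_dualStep hV hZ'

theorem measurable_x_sub_xhat {mΩ : MeasurableSpace Ω} [MeasurableSpace Ξ]
    (hS : IsRandomRun L f 𝒞 α β γ ω s x0 ξ S) (h𝒞 : Measurable (Function.uncurry 𝒞))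
    (hf : ∀ i, IsSmoothWith ℓ (f i)) (k : ℕ) (hξ : ∀ j < k, ∀ i, Measurable (ξ j i)) (i : Fin n) :
    Measurable[mΩ] fun w => (S k w).x i - (S k w).xhat i :=
  have state := hS.measurable_state h𝒞 hf k hξ
  (measurable_pi_iff.1 state.1 i).sub (measurable_pi_iff.1 state.2.2 i)

variable [MeasurableSpace Ω] [MeasurableSpace Ξ] {μ : Measure Ω} {ν : Measure Ξ}

theorem indepFun (hS : IsRandomRun L f 𝒞 α β γ ω s x0 ξ S)
    (h𝒞 : Measurable (Function.uncurry 𝒞)) (hf : ∀ i, IsSmoothWith ℓ (f i))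
    (hξ : IsFreshRandomness μ ν ξ) (k : ℕ) (i : Fin n) :
    IndepFun (fun w => (S k w).x i - (S k w).xhat i) (ξ k i) μ := by
  let σ : ℕ → MeasurableSpace Ω :=
    fun j => MeasurableSpace.comap (fun w i => ξ j i w) MeasurableSpace.pi
  have measurable_draw : ∀ j i, Measurable[σ j] (ξ j i) := fun j i =>
    (measurable_pi_apply i).comp (comap_measurable fun w i => ξ j i w)
  have past_indep_present : Indep (⨆ j ∈ Set.Iio k, σ j) (⨆ j ∈ ({k} : Set ℕ), σ j) μ :=
    indep_iSup_of_disjoint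
      (fun j => (measurable_pi_lambda _ fun i => hξ.measurable j i).comap_le) hξ.indep.iIndep
      (Set.disjoint_singleton_right.2 Set.self_notMem_Iio)
  have measurable_past := hS.measurable_x_sub_xhat (mΩ := ⨆ j ∈ Set.Iio k, σ j) h𝒞 hf k
    (fun j hj i => (measurable_draw j i).mono (le_iSup₂_of_le j hj le_rfl) le_rfl) i
  rw [iSup_singleton] at past_indep_present
  exact indep_of_indep_of_le_left (indep_of_indep_of_le_right past_indep_present
    (measurable_draw k i).comap_le) measurable_past.comap_le

variable [IsProbabilityMeasure μ]

theorem memLp_state (hS : IsRandomRun L f 𝒞 α β γ ω s x0 ξ S)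
    (h𝒞 : IsGloballyBounded ν 𝒞 r δ C) (hr : r ≠ 0) (hf : ∀ i, IsSmoothWith ℓ (f i))
    (hξ : IsFreshRandomness μ ν ξ) (k : ℕ) :
    MemLp (fun w => (S k w).x) 2 μ ∧ MemLp (fun w => (S k w).v) 2 μ ∧
      MemLp (fun w => (S k w).xhat) 2 μ := by
  induction k with
  | zero =>
    simp only [hS 0]
    exact ⟨memLp_const _, memLp_const _, memLp_const _⟩
  | succ k ih =>
    obtain ⟨hX, hV, hZ⟩ := ih
    have hZ' : MemLp (fun w => (S (k + 1) w).xhat) 2 μ := by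
      refine .of_eval fun i => ?_
      simp only [hS.xhat_succ]
      exact (hZ.eval i).add ((h𝒞.memLp_compress hr
        (hS.measurable_x_sub_xhat h𝒞.measurable hf k (fun j _ => hξ.measurable j) i)
        ((hX.eval i).sub (hZ.eval i)) (hξ.measurable k i) (hξ.law k i)
        (hS.indepFun h𝒞.measurable hf hξ k i) (s k)).const_smul (ω * s k))
    refine ⟨?_, ?_, hZ'⟩
    · simp only [hS.x_succ]
      exact memLp_primalStep hf hX hV hZ'
    · simp only [hS.v_succ]
      exact memLp_dualStep hV hZ'

theorem integral_norm_sq_sub_xhat_succ_le (hS : IsRandomRun L f 𝒞 α β γ ω s x0 ξ S)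
    (h𝒞 : IsGloballyBounded ν 𝒞 r δ C) (hr : 0 < r) (hω : ω ∈ Set.Ioc 0 (1 / r)) {k : ℕ}
    (hs : s k ≠ 0) (hf : ∀ i, IsSmoothWith ℓ (f i)) (hξ : IsFreshRandomness μ ν ξ) (i : Fin n) :
    ∫ w, ‖(S k w).x i - (S (k + 1) w).xhat i‖ ^ 2 ∂μ
      ≤ (1 - ω * r * δ) * ∫ w, ‖(S k w).x i - (S k w).xhat i‖ ^ 2 ∂μ + ω * r * C * s k ^ 2 := by
  obtain ⟨hX, -, hZ⟩ := hS.memLp_state h𝒞 hr.ne' hf hξ k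
  simp only [hS.xhat_succ, ← sub_sub]
  exact h𝒞.integral_norm_sq_sub_compress_le hr hω hs
    (hS.measurable_x_sub_xhat h𝒞.measurable hf k (fun j _ => hξ.measurable j) i)
    ((hX.eval i).sub (hZ.eval i)) (hξ.measurable k i) (hξ.law k i)
    (hS.indepFun h𝒞.measurable hf hξ k i)

theorem meanSqDist_xhat_succ_le (hS : IsRandomRun L f 𝒞 α β γ ω s x0 ξ S)
    (h𝒞 : IsGloballyBounded ν 𝒞 r δ C) (hr : 0 < r) (hω : ω ∈ Set.Ioc 0 (1 / r)) {k : ℕ}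
    (hs : s k ≠ 0) (hf : ∀ i, IsSmoothWith ℓ (f i)) (hξ : IsFreshRandomness μ ν ξ) :
    meanSqDist μ (fun w => (S k w).x) (fun w => (S (k + 1) w).xhat)
      ≤ (1 - ω * r * δ) * meanSqDist μ (fun w => (S k w).x) (fun w => (S k w).xhat)
        + n * (ω * r * C * s k ^ 2) := by
  have hLp := hS.memLp_state h𝒞 hr.ne' hf hξ
  rw [meanSqDist_eq_sum (hLp k).1 (hLp (k + 1)).2.2, meanSqDist_eq_sum (hLp k).1 (hLp k).2.2]
  have sum_le := Finset.sum_le_sum fun i (_ : i ∈ Finset.univ) =>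
    hS.integral_norm_sq_sub_xhat_succ_le h𝒞 hr hω hs hf hξ i
  rwa [Finset.sum_add_distrib, ← Finset.mul_sum, Finset.sum_const, Finset.card_univ,
    Fintype.card_fin, nsmul_eq_mul] at sum_le

end IsRandomRun

end Run

section Convergence

theorem add_sum_range_le_of_succ_le {U D e : ℕ → ℝ} (h : ∀ k, U (k + 1) ≤ U k - D k + e k)
    (T : ℕ) : U T + ∑ k ∈ Finset.range T, D k ≤ U 0 + ∑ k ∈ Finset.range T, e k := by
  induction T with
  | zero => simp only [Finset.sum_range_zero, le_refl]
  | succ T ih =>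
    rw [Finset.sum_range_succ, Finset.sum_range_succ]
    linarith [h T]

theorem isBigO_one_of_nonneg_of_le {a : ℕ → ℝ} {B : ℝ} (h₀ : ∀ T, 0 ≤ a T)
    (hB : ∀ T, a T ≤ B) : a =O[atTop] fun _ => (1 : ℝ) :=
  .of_bound B (Eventually.of_forall fun T => by
    rw [norm_one, mul_one, Real.norm_of_nonneg (h₀ T)]
    exact hB T)

theorem isBigO_one_div_mul_of_nonneg_of_le {a : ℕ → ℝ} {B : ℝ} (h₀ : ∀ T, 0 ≤ a T)
    (hB : ∀ T, a T ≤ B) :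
    (fun T : ℕ => 1 / (T : ℝ) * a T) =O[atTop] fun T : ℕ => 1 / (T : ℝ) := by
  simpa only [mul_one] using
    (isBigO_refl (fun T : ℕ => 1 / (T : ℝ)) atTop).mul (isBigO_one_of_nonneg_of_le h₀ hB)

variable {n d : ℕ} {Ω Ξ : Type*} [MeasurableSpace Ω] [MeasurableSpace Ξ]
  {μ : Measure Ω} {ν : Measure Ξ} {A : Matrix (Fin n) (Fin n) ℝ}
  {f : Fin n → EuclideanSpace ℝ (Fin d) → ℝ}
  {𝒞 : Ξ → EuclideanSpace ℝ (Fin d) → EuclideanSpace ℝ (Fin d)}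
  {α β γ ω ℓ m r δ C c ε : ℝ} {s : ℕ → ℝ} {x0 : Fin n → EuclideanSpace ℝ (Fin d)}
  {ξ : ℕ → Fin n → Ω → Ξ} {S : ℕ → Ω → State n d}

theorem IsGloballyBounded.const_nonneg (h𝒞 : IsGloballyBounded ν 𝒞 r δ C) : 0 ≤ C := by
  have at_zero := (integral_nonneg fun _ => sq_nonneg _).trans (h𝒞.bound 0)
  rwa [norm_zero, zero_pow two_ne_zero, mul_zero, zero_add] at at_zero

/-- The quantity that the theorem bounds on average: it vanishes exactly when the agents agree on
a stationary point of the global cost. -/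
def stationarityGap (f : Fin n → EuclideanSpace ℝ (Fin d) → ℝ)
    (x : Fin n → EuclideanSpace ℝ (Fin d)) : ℝ :=
  ‖gradient (globalCost f) (avg x)‖ ^ 2 + 1 / (n : ℝ) * disagreement x

theorem stationarityGap_nonneg (x : Fin n → EuclideanSpace ℝ (Fin d)) :
    0 ≤ stationarityGap f x := by
  have := disagreement_nonneg x
  unfold stationarityGap
  positivity

theorem min_mul_stationarityGap_le (hn : n ≠ 0) (p q : ℝ) (x : Fin n → EuclideanSpace ℝ (Fin d)) :
    min p q * n * stationarityGap f x
      ≤ p * disagreement x + q * (n * ‖gradient (globalCost f) (avg x)‖ ^ 2) := by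
  have := disagreement_nonneg x
  calc min p q * n * stationarityGap f x
      = min p q * disagreement x
          + min p q * (n * ‖gradient (globalCost f) (avg x)‖ ^ 2) := by
        unfold stationarityGap
        field_simp
        ring
    _ ≤ p * disagreement x + q * (n * ‖gradient (globalCost f) (avg x)‖ ^ 2) := by
        gcongr
        exacts [min_le_left p q, min_le_right p q]

theorem integrable_stationarityGap [IsFiniteMeasure μ] (hn : n ≠ 0)
    (hf : ∀ i, IsSmoothWith ℓ (f i)) {X : Ω → Fin n → EuclideanSpace ℝ (Fin d)}
    (hX : MemLp X 2 μ) : Integrable (fun w => stationarityGap f (X w)) μ :=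
  (((isSmoothWith_globalCost hn hf).memLp_gradient (memLp_avg hX)).integrable_norm_pow
    two_ne_zero).add ((integrable_disagreement hX).const_mul _)

/-- The Lyapunov function of the algorithm with compression: the last term is the expected squared
error of the estimates after iteration `k`, as estimates of the positions at its start. -/
def potential (μ : Measure Ω) (hA : IsConnectedWeights A)
    (f : Fin n → EuclideanSpace ℝ (Fin d) → ℝ) (β γ m : ℝ) (S : ℕ → Ω → State n d) (k : ℕ) : ℝ :=
  ∫ w, lyapunov hA f β γ m (S k w).x (S k w).v ∂μ
    + meanSqDist μ (fun w => (S k w).x) (fun w => (S (k + 1) w).xhat)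

theorem exists_pos_lyapunov_add_le (hA : IsConnectedWeights A) (hn : 2 ≤ n)
    (hf : ∀ i, IsSmoothWith ℓ (f i))
    (hα : StepsizeConditions (rho (laplacian A)) (rhoTwo (laplacian A)) ℓ α β γ c ε) :
    ∃ a > 0, ∀ x v z, ∑ i, v i = 0 →
      lyapunov hA f β γ m (primalStep (laplacian A) f α β γ x v z)
            (dualStep (laplacian A) α γ v z)
          + c * ∑ i, ‖primalStep (laplacian A) f α β γ x v z i - x i‖ ^ 2
          + a * stationarityGap f x
        ≤ lyapunov hA f β γ m x v + 2 * ε * ∑ i, ‖x i - z i‖ ^ 2 := by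
  set ρ := rho (laplacian A)
  set ρ₂ := rhoTwo (laplacian A)
  have disagreement_coeff_pos : 0 < α * phiOne ρ₂ ℓ β γ - α ^ 2 * phiTwo' ρ ρ₂ ℓ β γ c := by
    linarith [mul_pos hα.stepsize_pos (sub_pos.2 hα.disagreement_coeff)]
  refine ⟨min (α * phiOne ρ₂ ℓ β γ - α ^ 2 * phiTwo' ρ ρ₂ ℓ β γ c) (α / 2) * n,
    mul_pos (lt_min disagreement_coeff_pos (half_pos hα.stepsize_pos)) (by positivity),
    fun x v z hv => ?_⟩
  have error_le := mul_le_mul_of_nonneg_right hα.error_coeff_le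
    (Finset.sum_nonneg fun i (_ : i ∈ Finset.univ) => sq_nonneg ‖x i - z i‖)
  have gap_le := min_mul_stationarityGap_le (f := f) (by omega)
    (α * phiOne ρ₂ ℓ β γ - α ^ 2 * phiTwo' ρ ρ₂ ℓ β γ c) (α / 2) x
  have step_le := lyapunov_step_le (m := m) (x := x) (z := z) hA hn hf hα hv rfl rfl
  linarith

namespace IsRandomRun

variable [IsProbabilityMeasure μ]

theorem exists_pos_integral_lyapunov_add_le (hA : IsConnectedWeights A)
    (hS : IsRandomRun (laplacian A) f 𝒞 α β γ ω s x0 ξ S) (hn : 2 ≤ n)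
    (hf : ∀ i, IsSmoothWith ℓ (f i)) (hm : ∀ z, m ≤ globalCost f z)
    (hα : StepsizeConditions (rho (laplacian A)) (rhoTwo (laplacian A)) ℓ α β γ c ε)
    (h𝒞 : IsGloballyBounded ν 𝒞 r δ C) (hr : r ≠ 0) (hξ : IsFreshRandomness μ ν ξ) :
    ∃ a > 0, ∀ k,
      ∫ w, lyapunov hA f β γ m (S (k + 1) w).x (S (k + 1) w).v ∂μ
          + c * meanSqDist μ (fun w => (S (k + 1) w).x) (fun w => (S k w).x)
          + a * ∫ w, stationarityGap f (S k w).x ∂μ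
        ≤ ∫ w, lyapunov hA f β γ m (S k w).x (S k w).v ∂μ
          + 2 * ε * meanSqDist μ (fun w => (S k w).x) (fun w => (S (k + 1) w).xhat) := by
  obtain ⟨a, a_pos, step_le⟩ := exists_pos_lyapunov_add_le (m := m) hA hn hf hα
  refine ⟨a, a_pos, fun k => ?_⟩
  have hLp := hS.memLp_state h𝒞 hr hf hξ
  have energy := fun k => integrable_lyapunov hA (by omega) hf hm β γ (hLp k).1 (hLp k).2.1
  have move := (integrable_sum_norm_sub_sq (hLp (k + 1)).1 (hLp k).1).const_mul c
  have error := (integrable_sum_norm_sub_sq (hLp k).1 (hLp (k + 1)).2.2).const_mul (2 * ε)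
  have gap := (integrable_stationarityGap (by omega) hf (hLp k).1).const_mul a
  have current := (energy (k + 1)).add move
  rw [meanSqDist, meanSqDist, ← integral_const_mul, ← integral_const_mul, ← integral_const_mul,
    ← integral_add (energy (k + 1)) move, ← integral_add (by exact current) gap,
    ← integral_add (energy k) error]
  refine integral_mono (current.add gap) ((energy k).add error) fun w => ?_
  simpa only [← hS.x_succ, ← hS.v_succ] using
    step_le (S k w).x (S k w).v (S (k + 1) w).xhat (hS.sum_v hA.symm k w)

theorem meanSqDist_xhat_succ_succ_le {L : Matrix (Fin n) (Fin n) ℝ}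
    (hS : IsRandomRun L f 𝒞 α β γ ω s x0 ξ S) (h𝒞 : IsGloballyBounded ν 𝒞 r δ C) (hr : 0 < r)
    (hδ : δ ∈ Set.Ioc (0 : ℝ) 1) (hω : ω ∈ Set.Ioc 0 (1 / r)) {k : ℕ} (hs : s (k + 1) ≠ 0)
    (hf : ∀ i, IsSmoothWith ℓ (f i)) (hξ : IsFreshRandomness μ ν ξ) :
    meanSqDist μ (fun w => (S (k + 1) w).x) (fun w => (S (k + 2) w).xhat)
      ≤ (1 - 2 * epsTwelve ω r δ)
            * meanSqDist μ (fun w => (S k w).x) (fun w => (S (k + 1) w).xhat)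
        + epsTen ω r δ * meanSqDist μ (fun w => (S (k + 1) w).x) (fun w => (S k w).x)
        + n * (ω * r * C * s (k + 1) ^ 2) := by
  have hLp := hS.memLp_state h𝒞 hr.ne' hf hξ
  obtain ⟨ε₉_pos, ε₉_le⟩ := epsNine_mem_Ioc hr hδ hω
  have contraction := hS.meanSqDist_xhat_succ_le h𝒞 hr hω hs hf hξ
  have drift := meanSqDist_le_weighted ε₉_pos (hLp (k + 1)).1 (hLp k).1 (hLp (k + 1)).2.2
  have scaled_drift := mul_le_mul_of_nonneg_left drift
    (by linarith : 0 ≤ 1 - 2 * epsNine ω r δ)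
  have rate : ω * r * δ = 2 * epsNine ω r δ := by
    unfold epsNine
    ring
  rw [rate] at contraction
  unfold epsTwelve epsTen
  linarith

theorem exists_pos_potential_succ_le (hA : IsConnectedWeights A)
    (hS : IsRandomRun (laplacian A) f 𝒞 α β γ ω s x0 ξ S) (hn : 2 ≤ n)
    (hf : ∀ i, IsSmoothWith ℓ (f i)) (hm : ∀ z, m ≤ globalCost f z)
    (hα : StepsizeConditions (rho (laplacian A)) (rhoTwo (laplacian A)) ℓ α β γ
      (epsTen ω r δ) (epsTwelve ω r δ))
    (h𝒞 : IsGloballyBounded ν 𝒞 r δ C) (hr : 0 < r) (hδ : δ ∈ Set.Ioc (0 : ℝ) 1)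
    (hω : ω ∈ Set.Ioc 0 (1 / r)) (hs : ∀ k, s k ≠ 0) (hξ : IsFreshRandomness μ ν ξ) :
    ∃ a > 0, ∀ k, potential μ hA f β γ m S (k + 1) ≤ potential μ hA f β γ m S k
      - a * ∫ w, stationarityGap f (S k w).x ∂μ + n * (ω * r * C * s (k + 1) ^ 2) := by
  obtain ⟨a, a_pos, step_le⟩ :=
    hS.exists_pos_integral_lyapunov_add_le hA hn hf hm hα h𝒞 hr.ne' hξ
  refine ⟨a, a_pos, fun k => ?_⟩
  have error_le := hS.meanSqDist_xhat_succ_succ_le h𝒞 hr hδ hω (hs (k + 1)) hf hξ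
  unfold potential
  linarith [step_le k]

theorem mul_integral_globalCost_sub_le_potential (hA : IsConnectedWeights A)
    {L : Matrix (Fin n) (Fin n) ℝ}
    (hS : IsRandomRun L f 𝒞 α β γ ω s x0 ξ S) (hn : 2 ≤ n)
    (hf : ∀ i, IsSmoothWith ℓ (f i)) (hm : ∀ z, m ≤ globalCost f z)
    (hα : StepsizeConditions (rho (laplacian A)) (rhoTwo (laplacian A)) ℓ α β γ c ε)
    (h𝒞 : IsGloballyBounded ν 𝒞 r δ C) (hr : r ≠ 0) (hξ : IsFreshRandomness μ ν ξ) (k : ℕ) :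
    n * ∫ w, (globalCost f (avg (S k w).x) - m) ∂μ ≤ potential μ hA f β γ m S k := by
  have hn₀ : n ≠ 0 := by omega
  obtain ⟨hX, hV, -⟩ := hS.memLp_state h𝒞 hr hf hξ k
  calc n * ∫ w, (globalCost f (avg (S k w).x) - m) ∂μ
      = ∫ w, n * (globalCost f (avg (S k w).x) - m) ∂μ := (integral_const_mul _ _).symm
    _ ≤ ∫ w, lyapunov hA f β γ m (S k w).x (S k w).v ∂μ :=
        integral_mono
          (((isSmoothWith_globalCost hn₀ hf).integrable_sub_const hm (memLp_avg hX)).const_mul _)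
          (integrable_lyapunov hA hn₀ hf hm β γ hX hV) fun w => le_lyapunov hA hn hα _ _
    _ ≤ potential μ hA f β γ m S k := le_add_of_nonneg_right (meanSqDist_nonneg _ _)

theorem exists_bound (hA : IsConnectedWeights A)
    (hS : IsRandomRun (laplacian A) f 𝒞 α β γ ω s x0 ξ S) (hn : 2 ≤ n)
    (hf : ∀ i, IsSmoothWith ℓ (f i)) (hm : ∀ z, m ≤ globalCost f z)
    (hα : StepsizeConditions (rho (laplacian A)) (rhoTwo (laplacian A)) ℓ α β γ
      (epsTen ω r δ) (epsTwelve ω r δ))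
    (h𝒞 : IsGloballyBounded ν 𝒞 r δ C) (hr : 0 < r) (hδ : δ ∈ Set.Ioc (0 : ℝ) 1)
    (hω : ω ∈ Set.Ioc 0 (1 / r)) (hs : ∀ k, s k ≠ 0) (hsum : Summable fun k => s k ^ 2)
    (hξ : IsFreshRandomness μ ν ξ) :
    ∃ B, ∀ T, ∑ k ∈ Finset.range T, ∫ w, stationarityGap f (S k w).x ∂μ ≤ B ∧
      ∫ w, (globalCost f (avg (S T w).x) - m) ∂μ ≤ B := by
  obtain ⟨a, a_pos, step_le⟩ := hS.exists_pos_potential_succ_le hA hn hf hm hα h𝒞 hr hδ hω hs hξ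
  have noise_summable : Summable fun k => n * (ω * r * C * s (k + 1) ^ 2) :=
    (((summable_nat_add_iff 1).2 hsum).mul_left _).mul_left _
  set P := potential μ hA f β γ m S 0 + ∑' k, n * (ω * r * C * s (k + 1) ^ 2)
  have telescoped : ∀ T, n * ∫ w, (globalCost f (avg (S T w).x) - m) ∂μ
      + a * ∑ k ∈ Finset.range T, ∫ w, stationarityGap f (S k w).x ∂μ ≤ P := fun T => by
    have hωr := mul_pos hω.1 hr
    have hC := h𝒞.const_nonneg
    rw [Finset.mul_sum]
    exact (add_le_add_left (hS.mul_integral_globalCost_sub_le_potential hA hn hf hm hα h𝒞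
      hr.ne' hξ T) _).trans <| (add_sum_range_le_of_succ_le step_le T).trans <|
      add_le_add_right (noise_summable.sum_le_tsum _ fun k _ => by positivity) _
  have cost_nonneg : ∀ T, 0 ≤ ∫ w, (globalCost f (avg (S T w).x) - m) ∂μ := fun T =>
    integral_nonneg fun w => sub_nonneg.2 (hm _)
  have gaps_nonneg : ∀ T, 0 ≤ ∑ k ∈ Finset.range T, ∫ w, stationarityGap f (S k w).x ∂μ :=
    fun T => Finset.sum_nonneg fun k _ => integral_nonneg fun w => stationarityGap_nonneg _
  have hn₀ : (0 : ℝ) < n := by positivity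
  refine ⟨max (P / a) (P / n), fun T => ⟨le_max_of_le_left ?_, le_max_of_le_right ?_⟩⟩
  · rw [le_div_iff₀' a_pos]
    linarith [telescoped T, mul_nonneg hn₀.le (cost_nonneg T)]
  · rw [le_div_iff₀' hn₀]
    linarith [telescoped T, mul_nonneg a_pos.le (gaps_nonneg T)]

end IsRandomRun

theorem pos_of_kappaTwo_lt {ρ₂ : ℝ} (hγ : kappaTwo ρ₂ ℓ < γ) : 0 < γ :=
  ((by positivity : (0 : ℝ) < 2 + 2 * ℓ ^ 2).trans_le
    ((le_max_left _ _).trans (le_max_left _ _))).trans hγ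

theorem summable_sq_mul_pow (a : ℝ) {b : ℝ} (hb : b ∈ Set.Ioo (0 : ℝ) 1) :
    Summable fun k : ℕ => (a * b ^ k) ^ 2 := by
  simpa only [mul_pow, pow_right_comm] using
    (summable_geometric_of_lt_one (sq_nonneg b) (pow_lt_one₀ hb.1.le hb.2 two_ne_zero)).mul_left
      (a ^ 2)

end Convergence

end CompressedOpt

end

theorem theorem4_general {n d : ℕ} (hn : 2 ≤ n)
    {Ω Ξ : Type*} [MeasurableSpace Ω] [MeasurableSpace Ξ]
    (μ : Measure Ω) [IsProbabilityMeasure μ] (ν : Measure Ξ)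
    (A : Matrix (Fin n) (Fin n) ℝ) (hA : CompressedOpt.IsConnectedWeights A)
    (L : Matrix (Fin n) (Fin n) ℝ) (hL : L = CompressedOpt.laplacian A)
    (f : Fin n → EuclideanSpace ℝ (Fin d) → ℝ) (ℓ : ℝ) (hℓ : 0 < ℓ)
    (hf : ∀ i, CompressedOpt.IsSmoothWith ℓ (f i))
    (hbdd : BddBelow (Set.range (CompressedOpt.globalCost f)))
    (𝒞 : Ξ → EuclideanSpace ℝ (Fin d) → EuclideanSpace ℝ (Fin d)) (r δ C : ℝ)
    (hr : 0 < r) (hδ : δ ∈ Set.Ioc (0 : ℝ) 1)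
    (h𝒞 : CompressedOpt.IsGloballyBounded ν 𝒞 r δ C)
    (ξ : ℕ → Fin n → Ω → Ξ) (hξ : CompressedOpt.IsFreshRandomness μ ν ξ)
    (x0 : Fin n → EuclideanSpace ℝ (Fin d)) (α β γ ω : ℝ) (hγ : 0 < γ)
    (hω : ω ∈ Set.Ioc 0 (1 / r))
    (hα : α ∈ Set.Ioo 0 (CompressedOpt.stepsizeBound (CompressedOpt.rho L)
      (CompressedOpt.rhoTwo L) ℓ β γ ω r δ))
    (s : ℕ → ℝ) (hs : ∀ k, s k ≠ 0) (hsum : Summable fun k => s k ^ 2)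
    (x : ℕ → Ω → Fin n → EuclideanSpace ℝ (Fin d))
    (hx : ∀ k w, x k w = (CompressedOpt.run L f 𝒞 α β γ ω s x0
      (fun k i => ξ k i w) k).x)
    (xbar : ℕ → Ω → EuclideanSpace ℝ (Fin d))
    (hxbar : ∀ k w, xbar k w = CompressedOpt.avg (x k w)) :
    (∀ k, Integrable (fun w => ‖gradient (CompressedOpt.globalCost f) (xbar k w)‖ ^ 2
        + 1 / (n : ℝ) * ∑ i, ‖x k w i - xbar k w‖ ^ 2) μ) ∧
    (fun T : ℕ => 1 / (T : ℝ) * ∑ k ∈ Finset.range T,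
        ∫ w, (‖gradient (CompressedOpt.globalCost f) (xbar k w)‖ ^ 2
          + 1 / (n : ℝ) * ∑ i, ‖x k w i - xbar k w‖ ^ 2) ∂μ)
      =O[atTop] (fun T : ℕ => 1 / (T : ℝ)) ∧
    (∀ T, Integrable (fun w => CompressedOpt.globalCost f (xbar T w)
        - ⨅ z, CompressedOpt.globalCost f z) μ) ∧
    (fun T : ℕ => ∫ w, (CompressedOpt.globalCost f (xbar T w)
        - ⨅ z, CompressedOpt.globalCost f z) ∂μ)
      =O[atTop] (fun _ : ℕ => (1 : ℝ)) := by
  subst hL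
  obtain rfl : x = fun k w => (CompressedOpt.run (CompressedOpt.laplacian A) f 𝒞 α β γ ω s x0
      (fun k i => ξ k i w) k).x := funext₂ hx
  obtain rfl : xbar = fun k w => CompressedOpt.avg (CompressedOpt.run (CompressedOpt.laplacian A)
      f 𝒞 α β γ ω s x0 (fun k i => ξ k i w) k).x := funext₂ hxbar
  have hn₀ : n ≠ 0 := by omega
  have hS : CompressedOpt.IsRandomRun (CompressedOpt.laplacian A) f 𝒞 α β γ ω s x0 ξ
    fun k w => CompressedOpt.run _ f 𝒞 α β γ ω s x0 (fun k i => ξ k i w) k := fun _ _ => rfl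
  have hα' := CompressedOpt.stepsizeConditions_of_mem_Ioo hℓ (hA.rhoTwo_laplacian_pos hn)
    (hA.rhoTwo_laplacian_le_rho hn) hγ
    (CompressedOpt.epsTen_nonneg (CompressedOpt.epsNine_mem_Ioc hr hδ hω)) hα
  have hX := fun k => (hS.memLp_state h𝒞 hr.ne' hf hξ k).1
  have hm := ciInf_le hbdd
  obtain ⟨B, hB⟩ := hS.exists_bound hA hn hf hm hα' h𝒞 hr hδ hω hs hsum hξ
  refine ⟨fun k => CompressedOpt.integrable_stationarityGap hn₀ hf (hX k),
    CompressedOpt.isBigO_one_div_mul_of_nonneg_of_le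
      (fun T => Finset.sum_nonneg fun k _ =>
        integral_nonneg fun w => CompressedOpt.stationarityGap_nonneg _) fun T => (hB T).1,
    fun T => (CompressedOpt.isSmoothWith_globalCost hn₀ hf).integrable_sub_const hm
      (CompressedOpt.memLp_avg (hX T)),
    CompressedOpt.isBigO_one_of_nonneg_of_le (fun T => integral_nonneg fun w => sub_nonneg.2 (hm _))
      fun T => (hB T).2⟩

theorem theorem4 {n d : ℕ} (hn : 2 ≤ n)
    {Ω Ξ : Type*} [MeasurableSpace Ω] [MeasurableSpace Ξ]
    (μ : Measure Ω) [IsProbabilityMeasure μ] (ν : Measure Ξ) [IsProbabilityMeasure ν]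
    -- communication graph
    (A : Matrix (Fin n) (Fin n) ℝ) (hA : CompressedOpt.IsConnectedWeights A)
    (L : Matrix (Fin n) (Fin n) ℝ) (hL : L = CompressedOpt.laplacian A)
    -- cost functions
    (f : Fin n → EuclideanSpace ℝ (Fin d) → ℝ) (ℓ : ℝ) (hℓ : 0 < ℓ)
    (hf : ∀ i, CompressedOpt.IsSmoothWith ℓ (f i))
    (hbdd : BddBelow (Set.range (CompressedOpt.globalCost f)))
    -- compressor and its internal randomness
    (𝒞 : Ξ → EuclideanSpace ℝ (Fin d) → EuclideanSpace ℝ (Fin d)) (r δ C : ℝ)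
    (hr : 0 < r) (hδ : δ ∈ Set.Ioc (0 : ℝ) 1) (hC : 0 < C)
    (h𝒞 : CompressedOpt.IsGloballyBounded ν 𝒞 r δ C)
    (ξ : ℕ → Fin n → Ω → Ξ) (hξ : CompressedOpt.IsFreshRandomness μ ν ξ)
    -- algorithm parameters
    (x0 : Fin n → EuclideanSpace ℝ (Fin d)) (α β γ ω τ₁ s₀ ε : ℝ) (p : ℝ≥0∞) (hp : 1 ≤ p)
    (hτ₁ : CompressedOpt.kappaOne (CompressedOpt.rhoTwo L) ≤ τ₁)
    (hγ : CompressedOpt.kappaTwo (CompressedOpt.rhoTwo L) ℓ < γ)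
    (hβ : β = τ₁ * γ)
    (hω : ω ∈ Set.Ioc 0 (1 / r))
    (hα : α ∈ Set.Ioo 0 (CompressedOpt.stepsizeBound (CompressedOpt.rho L)
      (CompressedOpt.rhoTwo L) ℓ β γ ω r δ))
    (hs₀ : 0 < s₀) (hs₀' : ∀ i, ‖WithLp.toLp p (x0 i).ofLp‖ ≤ s₀)
    (hε : ε ∈ Set.Ioo (0 : ℝ) 1)
    -- the random iterates generated by the algorithm with `s_k = s₀ ε ^ k`, and their average
    (x : ℕ → Ω → Fin n → EuclideanSpace ℝ (Fin d))
    (hx : ∀ k w, x k w = (CompressedOpt.run L f 𝒞 α β γ ω (fun k => s₀ * ε ^ k) x0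
      (fun k i => ξ k i w) k).x)
    (xbar : ℕ → Ω → EuclideanSpace ℝ (Fin d))
    (hxbar : ∀ k w, xbar k w = CompressedOpt.avg (x k w)) :
    (∀ k, Integrable (fun w => ‖gradient (CompressedOpt.globalCost f) (xbar k w)‖ ^ 2
        + 1 / (n : ℝ) * ∑ i, ‖x k w i - xbar k w‖ ^ 2) μ) ∧
    (fun T : ℕ => 1 / (T : ℝ) * ∑ k ∈ Finset.range T,
        ∫ w, (‖gradient (CompressedOpt.globalCost f) (xbar k w)‖ ^ 2
          + 1 / (n : ℝ) * ∑ i, ‖x k w i - xbar k w‖ ^ 2) ∂μ)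
      =O[atTop] (fun T : ℕ => 1 / (T : ℝ)) ∧
    (∀ T, Integrable (fun w => CompressedOpt.globalCost f (xbar T w)
        - ⨅ z, CompressedOpt.globalCost f z) μ) ∧
    (fun T : ℕ => ∫ w, (CompressedOpt.globalCost f (xbar T w)
        - ⨅ z, CompressedOpt.globalCost f z) ∂μ)
      =O[atTop] (fun _ : ℕ => (1 : ℝ)) := by
  exact theorem4_general hn μ ν A hA L hL f ℓ hℓ hf hbdd 𝒞 r δ C hr hδ h𝒞 ξ hξ x0 α β γ ω
    (CompressedOpt.pos_of_kappaTwo_lt hγ) hω hα _ (fun k => (mul_pos hs₀ (pow_pos hε.1 k)).ne')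
    (CompressedOpt.summable_sq_mul_pow s₀ hε) x hx xbar hxbar
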